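/- **Setting.** Let $(G,P)$ be a quasi-lattice ordered groupoid: $G$ is a discrete groupoid, $P$ a wide subcategory with $P(x,y)\cap P(y,x)^{-1}=\emptyset$ for $x\ne y$ and $=\{1_x\}$ for $x=y$, and, for the order $f\le g\iff f^{-1}g\in P$ (between morphisms with the same target), every nonempty finite set of morphisms of $G$ with an upper bound in $P$ has a least upper bound in $P$. For $f,g\in P$ write $f\vee g$ for their least upper bound in $P$ if they have a common upper bound in $P$, and $f\vee g=\infty$ otherwise. $P(-,y)$ denotes the set of morphisms of $P$ with target $y$, and $s(f),t(f)$ the source and target of $f$. Let $X=(\{\mathcal A_x\},\{X_f\}_{f\in P},\{m_{g,f}\})$ be a product system over $(G,P)$: each $\mathcal A_x$ is a C$^*$-algebra, each $X_f$ is an $\mathcal A_{t(f)}$-$\mathcal A_{s(f)}$ C$^*$-correspondence (a right Hilbert $\mathcal A_{s(f)}$-module with a nondegenerate left action $\phi_f:\mathcal A_{t(f)}\to\mathcal L(X_f)$ by adjointable operators), and $m_{g,f}:X_g\otimes_{\mathcal A_{t(f)}}X_f\to X_{gf}$, written $\xi\otimes\eta\mapsto\xi\eta$, are unitary bimodule maps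 for $t(f)=s(g)$, which are associative, with $X_{1_x}=\mathcal A_x$, $m_{1,f}(a\otimes\xi)=a\xi$ and $m_{f,1}(\xi\otimes b)=\xi b$. For $f\le g$ let $l^g_f:\mathcal L(X_f)\to\mathcal L(X_g)$ be given by $l^g_f(T)(\xi\eta)=(T\xi)\eta$ ($\xi\in X_f$, $\eta\in X_{f^{-1}g}$), and let $l^g_f=0$ if $f\not\le g$. Assume that $X$ is compactly aligned: $S\vee T:=l_f^{f\vee g}(S)\,l_g^{f\vee g}(T)\in\mathcal K(X_{f\vee g})$ whenever $f\vee g<\infty$, $S\in\mathcal K(X_f)$, $T\in\mathcal K(X_g)$, where $\mathcal K$ denotes the compact operators (the closed span of the $\theta_{\xi,\eta}=\xi\langle\eta,\cdot\rangle$). For $g\in P(x,y)$ let $I_g=\bigcap_{1_y<f\le g}\ker\phi_f\subseteq\mathcal A_y$ if $x=y$ (so $I_{1_y}=\mathcal A_y$) and $I_g=0$ if $x\neq y$; let $\widetilde X_g$ be the completion of the pre-Hilbert $\mathcal A_x$-module of finitely supported families $(\xi(h))$ indexed by the $h\in P(x,y)$ with $h\le g$, $\xi(h)\in X_hI_{h^{-1}g}$,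 with inner product $\sum_h\langle\xi(h),\eta(h)\rangle$. For $f,g\in P(-,y)$ let $\widetilde l^g_f(T)$ be the operator $(\widetilde l^g_f(T)\xi)(h)=l^h_f(T)(\xi(h))$ on $\widetilde X_g$, and let $(\widetilde\phi_g(a)\xi)(h)=\phi_h(a)(\xi(h))$ for $a\in\mathcal A_y$. $X$ is $\widetilde\phi$-injective if all $\widetilde\phi_g$ are injective. A Toeplitz representation of $X$ in a C$^*$-algebra $\mathcal B$ is a family of linear maps $\psi_f:X_f\to\mathcal B$ such that each $\psi_{1_x}$ is a $*$-homomorphism, $\psi_g(\beta)\psi_f(\xi)=\psi_{gf}(\beta\xi)$ if $s(g)=t(f)$, and $\psi_f(\eta)^*\psi_f(\xi)=\psi_{1_{s(f)}}(\langle\eta,\xi\rangle)$. Let $\psi^{(f)}:\mathcal K(X_f)\to\mathcal B$ be the $*$-homomorphism with $\psi^{(f)}(\theta_{\xi,\eta})=\psi_f(\xi)\psi_f(\eta)^*$, and $\psi^{(\infty)}=0$. The representation is Nica covariant if $\psi^{(f)}(S)\psi^{(g)}(T)=\psi^{(f\vee g)}(S\vee T)$ for all $f,g\in P$ and compact $S,T$.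 For $\widetilde\phi$-injective $X$ it is Cuntz–Pimsner covariant if $\sum_{f\in F}\psi^{(f)}(T_f)=0$ for every object $y$, every finite $F\subseteq P(-,y)$ and all $T_f\in\mathcal K(X_f)$ such that $\sum_{f\in F}\widetilde l^g_f(T_f)=0$ for large $g$ (that is, for every $f_0\in P(-,y)$ there is $h\ge f_0$ in $P(-,y)$ such that this holds for all $g\ge h$). It is CNP-covariant if it is Nica covariant and Cuntz–Pimsner covariant (in particular $X$ is $\widetilde\phi$-injective). **Statement.** Suppose that for every object $y$ each pair in $P(-,y)$ has a least upper bound in $P$, and that for every $f\in P$ the left action $\phi_f:\mathcal A_{t(f)}\to\mathcal L(X_f)$ is injective with $\phi_f(\mathcal A_{t(f)})\subseteq\mathcal K(X_f)$. Let $\psi=\{\psi_f:X_f\to B(H)\}$ be a Toeplitz representation of $X$ on a Hilbert space $H$ with $\psi_{1_x}(\mathcal A_x)\psi_{1_y}(\mathcal A_y)=0$ for all objects $x\neq y$. Then $\psi$ is CNP-covariant if and only if $\psi^{(f)}(\phi_f(a))=\psi_{1_{t(f)}}(a)$ for all $f\in P$ and $a\in\mathcal A_{t(f)}$. -/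

import Mathlib

open CategoryTheory MulOpposite
open scoped TensorProduct RightActions

universe u v w₁ w₂

noncomputable section

set_option linter.unusedSectionVars false

namespace ProdSys

section HilbertModule

variable {A E : Type*} [NonUnitalCStarAlgebra A] [PartialOrder A] [StarOrderedRing A]
  [NormedAddCommGroup E] [NormedSpace ℂ E] [SMul Aᵐᵒᵖ E] [CStarModule Aᵐᵒᵖ E]

/-- The `A`-valued inner product `⟨x, y⟩` of a right Hilbert `A`-module `E`, conjugate linear in `x`
and with `⟨x, y a⟩ = ⟨x, y⟩ a`. A right Hilbert `A`-module is expressed as a `CStarModule` over the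
opposite algebra `Aᵐᵒᵖ` (the axioms of `CStarModule B E` are those of a left action,
`inner x (b • y) = b * inner x y`), and `x <• a = op a • x` is the right action `x a`. -/
def rin (A : Type*) {E : Type*} [Inner Aᵐᵒᵖ E] (x y : E) : A := unop (inner Aᵐᵒᵖ x y)

theorem rin_add_right (x y z : E) : rin A x (y + z) = rin A x y + rin A x z := by
  simp [rin]

theorem rin_add_left (x y z : E) : rin A (x + y) z = rin A x z + rin A y z := by
  simp [rin]

theorem rin_sub_left (x y z : E) : rin A (x - y) z = rin A x z - rin A y z := by
  simp [rin]

theorem rin_sub_right (x y z : E) : rin A x (y - z) = rin A x y - rin A x z := by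
  simp [rin]

theorem rin_zero_left (x : E) : rin A 0 x = 0 := by simp [rin]

theorem rin_zero_right (x : E) : rin A x 0 = 0 := by simp [rin]

theorem rin_smul_right (c : ℂ) (x y : E) : rin A x (c • y) = c • rin A x y := by
  simp [rin]

theorem rin_smul_left (c : ℂ) (x y : E) : rin A (c • x) y = star c • rin A x y := by
  simp [rin]

theorem rin_op_right (x y : E) (a : A) : rin A x (y <• a) = rin A x y * a := by
  simp [rin]

theorem star_rin (x y : E) : star (rin A x y) = rin A y x := by
  simp only [rin, ← unop_star, CStarModule.star_inner]

theorem rin_op_left (x y : E) (a : A) : rin A (x <• a) y = star a * rin A x y := by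
  rw [← star_rin, rin_op_right, star_mul, star_rin]

theorem rin_self_nonneg (x : E) : 0 ≤ rin A x x :=
  CStarModule.inner_self_nonneg (A := Aᵐᵒᵖ) (x := x)

theorem rin_self_eq_zero {x : E} : rin A x x = 0 ↔ x = 0 := by
  rw [rin, unop_eq_zero_iff]
  exact CStarModule.inner_self

theorem norm_sq_rin (x : E) : ‖x‖ ^ 2 = ‖rin A x x‖ :=
  CStarModule.norm_sq_eq Aᵐᵒᵖ

theorem norm_rin_le (x y : E) : ‖rin A x y‖ ≤ ‖x‖ * ‖y‖ :=
  CStarModule.norm_inner_le (A := Aᵐᵒᵖ) E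

variable (A) in
theorem ext_rin {x y : E} (h : ∀ z, rin A z x = rin A z y) : x = y := by
  rw [← sub_eq_zero, ← rin_self_eq_zero (A := A), rin_sub_right, h, sub_self]

theorem continuous_rin : Continuous fun p : E × E => rin A p.1 p.2 :=
  continuous_unop.comp (CStarModule.continuous_inner (A := Aᵐᵒᵖ) (E := E))

/-- Right multiplication by an element of `A`, as a linear map. -/
def rmulₗ (E : Type*) [NormedAddCommGroup E] [NormedSpace ℂ E] [SMul Aᵐᵒᵖ E] [CStarModule Aᵐᵒᵖ E]
    (a : A) : E →ₗ[ℂ] E where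
  toFun x := x <• a
  map_add' x y := ext_rin A fun z => by simp only [rin_op_right, rin_add_right, add_mul]
  map_smul' c x := ext_rin A fun z => by
    simp only [rin_op_right, rin_smul_right, smul_mul_assoc, RingHom.id_apply]

theorem norm_rmul_le (a : A) (x : E) : ‖x <• a‖ ≤ ‖a‖ * ‖x‖ := by
  refine le_of_sq_le_sq ?_ (by positivity)
  rw [norm_sq_rin (A := A), rin_op_right, rin_op_left]
  calc _ ≤ ‖star a‖ * ‖rin A x x‖ * ‖a‖ :=
        (norm_mul_le _ _).trans (by gcongr; exact norm_mul_le _ _)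
    _ = (‖a‖ * ‖x‖) ^ 2 := by rw [norm_star, ← norm_sq_rin]; ring

/-- Right multiplication by an element of `A`, as a bounded linear map. -/
def rmul (E : Type*) [NormedAddCommGroup E] [NormedSpace ℂ E] [SMul Aᵐᵒᵖ E] [CStarModule Aᵐᵒᵖ E]
    (a : A) : E →L[ℂ] E :=
  (rmulₗ E a).mkContinuous ‖a‖ (norm_rmul_le a)

@[simp] theorem rmul_apply (a : A) (x : E) : rmul E a x = x <• a := rfl

/-- `T` and `S` are adjoint to each other. -/
def IsAdjointPair (A : Type*) {E : Type*} [Inner Aᵐᵒᵖ E] (T S : E → E) : Prop :=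
  ∀ x y, rin A (T x) y = rin A x (S y)

theorem IsAdjointPair.symm {T S : E → E} (h : IsAdjointPair A T S) : IsAdjointPair A S T :=
  fun x y => by rw [← star_rin, ← h y x, star_rin]

variable (A E) in
/-- The adjointable operators on the right Hilbert `A`-module `E`, inside the bounded operators. -/
def adjointableSubalgebra : Subalgebra ℂ (E →L[ℂ] E) where
  carrier := {T | ∃ S : E →L[ℂ] E, IsAdjointPair A T S}
  mul_mem' := by
    rintro T T' ⟨S, h⟩ ⟨S', h'⟩
    exact ⟨S' * S, fun x y => by simp [h _ _, h' _ _]⟩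
  add_mem' := by
    rintro T T' ⟨S, h⟩ ⟨S', h'⟩
    exact ⟨S + S', fun x y => by simp [rin_add_left, rin_add_right, h _ _, h' _ _]⟩
  algebraMap_mem' c := ⟨algebraMap ℂ _ (star c), fun x y => by
    simp [Algebra.algebraMap_eq_smul_one, rin_smul_left, rin_smul_right]⟩

variable (A E) in
/-- `𝓛(E)`: the adjointable operators on the right Hilbert `A`-module `E`. -/
def Adjointable : Type _ := adjointableSubalgebra A E

instance : NormedRing (Adjointable A E) :=
  inferInstanceAs (NormedRing (adjointableSubalgebra A E))

instance : NormedAlgebra ℂ (Adjointable A E) :=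
  inferInstanceAs (NormedAlgebra ℂ (adjointableSubalgebra A E))

instance : CoeFun (Adjointable A E) fun _ => E → E := ⟨fun T => T.1⟩

theorem Adjointable.adj_unique {T S S' : E → E} (h : IsAdjointPair A T S)
    (h' : IsAdjointPair A T S') : S = S' :=
  funext fun y => ext_rin A fun x => by rw [← h, ← h']

/-- The adjoint of an adjointable operator. -/
instance : Star (Adjointable A E) where
  star T := ⟨T.2.choose, T.1, T.2.choose_spec.symm⟩

theorem rin_star_right (T : Adjointable A E) (x y : E) : rin A x (star T y) = rin A (T x) y :=
  (T.2.choose_spec x y).symm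

theorem rin_star_left (T : Adjointable A E) (x y : E) : rin A (star T x) y = rin A x (T y) := by
  rw [← star_rin, rin_star_right, star_rin]

theorem Adjointable.ext' {S T : Adjointable A E} (h : ∀ x y, rin A x (S y) = rin A x (T y)) :
    S = T :=
  Subtype.ext <| ContinuousLinearMap.ext fun y => ext_rin A fun x => h x y

theorem Adjointable.mul_apply (S T : Adjointable A E) (x : E) : (S * T) x = S (T x) := rfl

theorem Adjointable.add_apply (S T : Adjointable A E) (x : E) : (S + T) x = S x + T x := rfl

theorem Adjointable.smul_apply (c : ℂ) (T : Adjointable A E) (x : E) : (c • T) x = c • T x := rfl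

instance : StarRing (Adjointable A E) where
  star_involutive T := Adjointable.ext' fun x y => by rw [rin_star_right, rin_star_left]
  star_mul S T := Adjointable.ext' fun x y => by
    rw [rin_star_right, Adjointable.mul_apply, Adjointable.mul_apply, rin_star_right,
      rin_star_right]
  star_add S T := Adjointable.ext' fun x y => by
    rw [rin_star_right, Adjointable.add_apply, Adjointable.add_apply, rin_add_left, rin_add_right,
      rin_star_right, rin_star_right]

instance : StarModule ℂ (Adjointable A E) where
  star_smul c T := Adjointable.ext' fun x y => by
    rw [rin_star_right, Adjointable.smul_apply, Adjointable.smul_apply, rin_smul_left,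
      rin_smul_right, rin_star_right]

theorem Adjointable.norm_apply_le (T : Adjointable A E) (x : E) : ‖T x‖ ≤ ‖T‖ * ‖x‖ :=
  T.1.le_opNorm x

instance : CStarRing (Adjointable A E) where
  norm_mul_self_le T := by
    have key : ‖T‖ ≤ √‖star T * T‖ := by
      refine T.1.opNorm_le_bound (Real.sqrt_nonneg _) fun x => ?_
      refine le_of_sq_le_sq ?_ (by positivity)
      rw [norm_sq_rin (A := A), ← rin_star_right, mul_pow, Real.sq_sqrt (norm_nonneg _)]
      calc _ ≤ ‖x‖ * ‖(star T * T) x‖ := norm_rin_le _ _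
        _ ≤ ‖x‖ * (‖star T * T‖ * ‖x‖) := by gcongr; exact Adjointable.norm_apply_le _ _
        _ = _ := by ring
    calc ‖T‖ * ‖T‖ ≤ √‖star T * T‖ * √‖star T * T‖ := by gcongr
      _ = _ := Real.mul_self_sqrt (norm_nonneg _)

theorem Adjointable.isClosed [CompleteSpace E] :
    IsClosed (adjointableSubalgebra A E : Set (E →L[ℂ] E)) := by
  refine isClosed_of_closure_subset fun T hT => ?_
  obtain ⟨u, hu, hlim⟩ := mem_closure_iff_seq_limit.1 hT
  let v : ℕ → Adjointable A E := fun n => ⟨u n, hu n⟩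
  have hv : CauchySeq fun n => (star (v n)).1 := by
    have h1 : CauchySeq u := hlim.cauchySeq
    rw [Metric.cauchySeq_iff] at h1 ⊢
    intro ε hε
    obtain ⟨N, hN⟩ := h1 ε hε
    refine ⟨N, fun m hm n hn => ?_⟩
    have h2 : dist (star (v m)) (star (v n)) = dist (v m) (v n) := by
      rw [dist_eq_norm, dist_eq_norm, ← star_sub, norm_star]
    exact h2.trans_lt (hN m hm n hn)
  obtain ⟨S, hS⟩ := cauchySeq_tendsto_of_complete hv
  refine ⟨S, fun x y => ?_⟩
  have e1 : Filter.Tendsto (fun n => rin A (u n x) y) Filter.atTop (nhds (rin A (T x) y)) :=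
    (continuous_rin.tendsto (T x, y)).comp
      (((ContinuousLinearMap.apply ℂ E x).continuous.tendsto T |>.comp hlim).prodMk_nhds
        tendsto_const_nhds)
  have e2 : Filter.Tendsto (fun n => rin A x ((star (v n)).1 y)) Filter.atTop
      (nhds (rin A x (S y))) :=
    (continuous_rin.tendsto (x, S y)).comp
      (tendsto_const_nhds.prodMk_nhds
        ((ContinuousLinearMap.apply ℂ E y).continuous.tendsto S |>.comp hS))
  refine tendsto_nhds_unique e1 (e2.congr fun n => ?_)
  exact rin_star_right (v n) x y

/-- `𝓛(E)` is a C⋆-algebra. -/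
instance [CompleteSpace E] : CStarAlgebra (Adjointable A E) where
  toCompleteSpace := (Adjointable.isClosed (A := A) (E := E)).completeSpace_coe

/-- Adjointable operators are `A`-linear. -/
theorem Adjointable.map_op (T : Adjointable A E) (x : E) (a : A) : T (x <• a) = T x <• a :=
  ext_rin A fun z => by rw [← rin_star_left, rin_op_right, rin_op_right, rin_star_left]

/-- The rank one operator `θ_{ξ,η} : ζ ↦ ξ⟨η, ζ⟩`. -/
def theta (A : Type*) {E : Type*} [NonUnitalCStarAlgebra A] [PartialOrder A] [StarOrderedRing A]
    [NormedAddCommGroup E] [NormedSpace ℂ E] [SMul Aᵐᵒᵖ E] [CStarModule Aᵐᵒᵖ E]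
    (ξ η : E) : Adjointable A E :=
  ⟨LinearMap.mkContinuous
    { toFun := fun ζ => ξ <• rin A η ζ
      map_add' := fun x y => ext_rin A fun z => by
        simp only [rin_op_right, rin_add_right, mul_add]
      map_smul' := fun c x => ext_rin A fun z => by
        simp only [rin_op_right, rin_smul_right, mul_smul_comm, RingHom.id_apply] }
    (‖ξ‖ * ‖η‖) fun ζ => by
      calc ‖ξ <• rin A η ζ‖ ≤ ‖rin A η ζ‖ * ‖ξ‖ := norm_rmul_le _ _
        _ ≤ (‖η‖ * ‖ζ‖) * ‖ξ‖ := by gcongr; exact norm_rin_le _ _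
        _ = _ := by ring,
   LinearMap.mkContinuous
    { toFun := fun ζ => η <• rin A ξ ζ
      map_add' := fun x y => ext_rin A fun z => by
        simp only [rin_op_right, rin_add_right, mul_add]
      map_smul' := fun c x => ext_rin A fun z => by
        simp only [rin_op_right, rin_smul_right, mul_smul_comm, RingHom.id_apply] }
    (‖ξ‖ * ‖η‖) fun ζ => by
      calc ‖η <• rin A ξ ζ‖ ≤ ‖rin A ξ ζ‖ * ‖η‖ := norm_rmul_le _ _
        _ ≤ (‖ξ‖ * ‖ζ‖) * ‖η‖ := by gcongr; exact norm_rin_le _ _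
        _ = _ := by ring,
   fun x y => by
    change rin A (ξ <• rin A η x) y = rin A x (η <• rin A ξ y)
    rw [rin_op_left, rin_op_right, star_rin]⟩

theorem theta_apply (ξ η ζ : E) : theta A ξ η ζ = ξ <• rin A η ζ := rfl

variable (A E) in
/-- `𝓚(E)`: the compact operators, i.e. the closed linear span of the rank one operators. -/
def Compacts : Submodule ℂ (Adjointable A E) :=
  (Submodule.span ℂ {T | ∃ ξ η, T = theta A ξ η}).topologicalClosure

theorem theta_mem (ξ η : E) : theta A ξ η ∈ Compacts A E :=
  Submodule.le_topologicalClosure _ (Submodule.subset_span ⟨ξ, η, rfl⟩)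

/-- Every adjointable operator `T` has a complement `C` with `T⋆T + C⋆C = ‖T‖²`. -/
theorem Adjointable.exists_compl [CompleteSpace E] (T : Adjointable A E) :
    ∃ C : Adjointable A E, star T * T + star C * C = algebraMap ℂ _ ((‖T‖ : ℂ) ^ 2) := by
  let _ := CStarAlgebra.spectralOrder (Adjointable A E)
  have _ := CStarAlgebra.spectralOrderedRing (Adjointable A E)
  have h := CStarAlgebra.star_mul_le_algebraMap_norm_sq (a := T)
  obtain ⟨C, hC⟩ := (CStarAlgebra.nonneg_iff_eq_star_mul_self).1 (sub_nonneg.2 h)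
  refine ⟨C, ?_⟩
  rw [← hC, add_sub_cancel]
  rw [IsScalarTower.algebraMap_apply ℝ ℂ (Adjointable A E)]
  simp

theorem Adjointable.rin_add_compl [CompleteSpace E] {T C : Adjointable A E}
    (h : star T * T + star C * C = algebraMap ℂ _ ((‖T‖ : ℂ) ^ 2)) (x y : E) :
    rin A (T x) (T y) + rin A (C x) (C y) = ((‖T‖ : ℂ) ^ 2) • rin A x y := by
  rw [← rin_star_right, ← rin_star_right, ← rin_add_right, ← rin_smul_right]
  congr 1
  exact congrArg (fun S : Adjointable A E => S y) h

theorem Adjointable.rin_apply_le [CompleteSpace E] (T : Adjointable A E) (x : E) :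
    rin A (T x) (T x) ≤ ((‖T‖ : ℂ) ^ 2) • rin A x x := by
  obtain ⟨C, hC⟩ := T.exists_compl
  rw [← Adjointable.rin_add_compl hC]
  exact le_add_of_nonneg_right (rin_self_nonneg _)

end HilbertModule

section Groupoid

variable {G : Type u} [Groupoid.{v} G] (P : MorphismProperty G)

/-- `P(x, y)`: the morphisms `x ⟶ y` that belong to the subcategory `P`. -/
abbrev PHom (x y : G) := {f : x ⟶ y // P f}

/-- The relation `f ≤ g`, i.e. `f⁻¹g ∈ P`, for morphisms `f`, `g` of `G` with the same target. In
diagrammatic order the composite `f⁻¹g` ("first `g`, then `f⁻¹`") is `g ≫ inv f`. -/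
def MorLE {x y z : G} (f : y ⟶ z) (g : x ⟶ z) : Prop := P (g ≫ Groupoid.inv f)

/-- `(G, P)` is a quasi-lattice ordered groupoid (the wide subcategory `P` being a class of
morphisms that contains the identities and is closed under composition): `P(x,y) ∩ P⁻¹(x,y)` is
empty for `x ≠ y` and `{1_x}` for `x = y`, and every finite set of morphisms of `G` with an upper
bound in `P` has a least upper bound in `P`. Only morphisms with the same target are comparable, so
the finite sets to be considered are the nonempty sets of morphisms with a common target `y`. -/
structure IsQuasiLatticeOrdered [P.IsMultiplicative] : Prop where
  inter_inv : ∀ x y : G, {f : x ⟶ y | P f ∧ P (Groupoid.inv f)} =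
    {f : x ⟶ y | ∃ h : x = y, f = eqToHom h}
  exists_lub : ∀ (y : G) (F : Finset (Σ x : G, x ⟶ y)), F.Nonempty →
    (∃ (x : G) (p : PHom P x y), ∀ f ∈ F, MorLE P f.2 p.1) →
    ∃ (x : G) (p : PHom P x y), (∀ f ∈ F, MorLE P f.2 p.1) ∧
      ∀ (x' : G) (q : PHom P x' y), (∀ f ∈ F, MorLE P f.2 q.1) → MorLE P p.1 q.1

/-- `P(-, y)`: the morphisms of `P` with target `y`. -/
structure PTo (y : G) where
  /-- the source -/
  src : G
  /-- the morphism -/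
  hom : PHom P src y

variable {P} [P.IsMultiplicative]

/-- The order `f ≤ g ↔ f⁻¹g ∈ P` on `P(-, y)`. -/
instance (y : G) : Preorder (PTo P y) where
  le f g := MorLE P f.hom.1 g.hom.1
  le_refl f := by
    simp only [MorLE, Groupoid.comp_inv]
    exact P.id_mem _
  le_trans f g h hfg hgh := by
    have := P.comp_mem _ _ hgh hfg
    simpa [MorLE] using this

/-- The identity morphism `1_y` as a morphism of `P`. -/
def PHom.one (y : G) : PHom P y y := ⟨𝟙 y, P.id_mem y⟩

/-- The identity morphism `1_y` as an element of `P(-, y)`. -/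
def PTo.one (y : G) : PTo P y := ⟨y, PHom.one y⟩

theorem one_morLE {x y : G} (f : PHom P x y) : MorLE P (PHom.one (P := P) y).1 f.1 := by
  simpa [MorLE, PHom.one] using f.2

/-- The element `f⁻¹g` of `P`, for `f ≤ g` in `P`. -/
def quot {x y z : G} {f : PHom P y z} {g : PHom P x z} (h : MorLE P f.1 g.1) : PHom P x y :=
  ⟨g.1 ≫ Groupoid.inv f.1, h⟩

theorem quot_comp {x y z : G} {f : PHom P y z} {g : PHom P x z} (h : MorLE P f.1 g.1) :
    (quot h).1 ≫ f.1 = g.1 := by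
  simp [quot]

end Groupoid

/-- A product system over `(G, P)`. The morphism `k = g f` ("first `f`, then `g`") of `P` is
written `f ≫ g = k`. -/
structure ProductSystem {G : Type u} [Groupoid.{v} G] (P : MorphismProperty G) [P.IsMultiplicative] where
  /-- the C⋆-algebras `A_x` -/
  A : G → Type w₁
  [instA : ∀ x, NonUnitalCStarAlgebra (A x)]
  [instOrder : ∀ x, PartialOrder (A x)]
  [instStarOrdered : ∀ x, StarOrderedRing (A x)]
  /-- the right Hilbert `A_{s(f)}`-modules `X_f` -/
  X : ∀ {x y : G}, PHom P x y → Type w₂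
  [instNorm : ∀ {x y : G} (f : PHom P x y), NormedAddCommGroup (X f)]
  [instSpace : ∀ {x y : G} (f : PHom P x y), NormedSpace ℂ (X f)]
  [instComplete : ∀ {x y : G} (f : PHom P x y), CompleteSpace (X f)]
  [instSMul : ∀ {x y : G} (f : PHom P x y), SMul (A x)ᵐᵒᵖ (X f)]
  [instModule : ∀ {x y : G} (f : PHom P x y), CStarModule (A x)ᵐᵒᵖ (X f)]
  /-- the left actions `φ_f : A_{t(f)} → 𝓛(X_f)` -/
  φ : ∀ {x y : G} (f : PHom P x y), A y →⋆ₙₐ[ℂ] Adjointable (A x) (X f)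
  /-- the left actions are nondegenerate -/
  nondegenerate : ∀ {x y : G} (f : PHom P x y),
    (Submodule.span ℂ {ζ : X f | ∃ a ξ, ζ = φ f a ξ}).topologicalClosure = ⊤
  /-- the identification `A_x = X_{1_x}`, where `A_x` carries its standard structure of a
  correspondence over itself -/
  unit : ∀ x : G, A x ≃ₗ[ℂ] X (PHom.one (P := P) x)
  rin_unit : ∀ (x : G) (a b : A x), rin (A x) (unit x a) (unit x b) = star a * b
  unit_right : ∀ (x : G) (a b : A x), unit x (a * b) = unit x a <• b
  unit_left : ∀ (x : G) (a b : A x), unit x (a * b) = φ (PHom.one x) a (unit x b)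
  /-- the multiplication `(ξ, η) ↦ ξη = m_{g,f}(ξ ⊗ η)`, for `k = gf`. -/
  mul : ∀ {x y z : G} (f : PHom P x y) (g : PHom P y z) (k : PHom P x z), f.1 ≫ g.1 = k.1 →
    X g →ₗ[ℂ] X f →ₗ[ℂ] X k
  /-- the multiplication is balanced over `A_{t(f)}`, -/
  mul_balanced : ∀ {x y z : G} (f : PHom P x y) (g : PHom P y z) (k : PHom P x z)
    (h : f.1 ≫ g.1 = k.1) (ξ : X g) (b : A y) (η : X f),
    mul f g k h (ξ <• b) η = mul f g k h ξ (φ f b η)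
  /-- it is a bimodule map, -/
  mul_left : ∀ {x y z : G} (f : PHom P x y) (g : PHom P y z) (k : PHom P x z)
    (h : f.1 ≫ g.1 = k.1) (a : A z) (ξ : X g) (η : X f),
    mul f g k h (φ g a ξ) η = φ k a (mul f g k h ξ η)
  mul_right : ∀ {x y z : G} (f : PHom P x y) (g : PHom P y z) (k : PHom P x z)
    (h : f.1 ≫ g.1 = k.1) (ξ : X g) (η : X f) (c : A x),
    mul f g k h ξ (η <• c) = mul f g k h ξ η <• c
  /-- it preserves the inner product `⟨ξ ⊗ η, ξ' ⊗ η'⟩ = ⟨η, ⟨ξ, ξ'⟩η'⟩` of the interior tensor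
  product `X_g ⊗ X_f`, -/
  rin_mul : ∀ {x y z : G} (f : PHom P x y) (g : PHom P y z) (k : PHom P x z)
    (h : f.1 ≫ g.1 = k.1) (ξ ξ' : X g) (η η' : X f),
    rin (A x) (mul f g k h ξ η) (mul f g k h ξ' η') = rin (A x) η (φ f (rin (A y) ξ ξ') η')
  /-- and its image on the algebraic tensor product is dense: together with the preceding
  conditions this says exactly that it extends to a unitary bimodule map from the completion
  `X_g ⊗ X_f` of the algebraic balanced tensor product onto `X_{gf}`. -/
  mul_dense : ∀ {x y z : G} (f : PHom P x y) (g : PHom P y z) (k : PHom P x z)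
    (h : f.1 ≫ g.1 = k.1), DenseRange (TensorProduct.lift (mul f g k h))
  one_mul : ∀ {x y : G} (f : PHom P x y) (h : f.1 ≫ (PHom.one (P := P) y).1 = f.1) (a : A y)
    (ξ : X f), mul f (PHom.one y) f h (unit y a) ξ = φ f a ξ
  mul_one : ∀ {x y : G} (f : PHom P x y) (h : (PHom.one (P := P) x).1 ≫ f.1 = f.1) (b : A x)
    (ξ : X f), mul (PHom.one x) f f h ξ (unit x b) = ξ <• b
  mul_assoc : ∀ {w x y z : G} (f : PHom P w x) (g : PHom P x y) (h : PHom P y z)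
    (gf : PHom P w y) (hg : PHom P x z) (hgf : PHom P w z) (e₁ : f.1 ≫ g.1 = gf.1)
    (e₂ : g.1 ≫ h.1 = hg.1) (e₃ : gf.1 ≫ h.1 = hgf.1) (e₄ : f.1 ≫ hg.1 = hgf.1)
    (ζ : X h) (η : X g) (ξ : X f),
    mul f hg hgf e₄ (mul g h hg e₂ ζ η) ξ = mul gf h hgf e₃ ζ (mul f g gf e₁ η ξ)

attribute [instance] ProductSystem.instA ProductSystem.instOrder ProductSystem.instStarOrdered
  ProductSystem.instNorm ProductSystem.instSpace ProductSystem.instComplete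
  ProductSystem.instSMul ProductSystem.instModule

namespace ProductSystem

variable {G : Type u} [Groupoid.{v} G] {P : MorphismProperty G} [P.IsMultiplicative]
  (X : ProductSystem.{u, v, w₁, w₂} P)

/-- `𝓛(X_f)` -/
abbrev L {x y : G} (f : PHom P x y) := Adjointable (X.A x) (X.X f)

/-- `𝓚(X_f)` -/
abbrev K {x y : G} (f : PHom P x y) : Submodule ℂ (X.L f) := Compacts (X.A x) (X.X f)

section ell

variable {x y z : G} {f : PHom P y z} {g : PHom P x z}

/-- The multiplication `X_f ⊗ X_{f⁻¹g} → X_g`, on the algebraic tensor product. -/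
def mulT (h : MorLE P f.1 g.1) : X.X f ⊗[ℂ] X.X (quot h) →ₗ[ℂ] X.X g :=
  TensorProduct.lift (X.mul (quot h) f g (quot_comp h))

/-- `T ⊗ 1` on the algebraic tensor product `X_f ⊗ X_{f⁻¹g}`. -/
def ampl (h : MorLE P f.1 g.1) (T : X.L f) :
    X.X f ⊗[ℂ] X.X (quot h) →ₗ[ℂ] X.X f ⊗[ℂ] X.X (quot h) :=
  TensorProduct.map (T.1 : X.X f →ₗ[ℂ] X.X f) LinearMap.id

theorem rin_mulT_ampl (h : MorLE P f.1 g.1) (T S T' S' : X.L f)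
    (hTS : ∀ ξ η, rin (X.A y) (T ξ) (S η) = rin (X.A y) (T' ξ) (S' η))
    (u v : X.X f ⊗[ℂ] X.X (quot h)) :
    rin (X.A x) (X.mulT h (X.ampl h T u)) (X.mulT h (X.ampl h S v)) =
      rin (X.A x) (X.mulT h (X.ampl h T' u)) (X.mulT h (X.ampl h S' v)) := by
  induction u with
  | zero => simp [rin_zero_left]
  | add u₁ u₂ h₁ h₂ => simp only [map_add, rin_add_left, h₁, h₂]
  | tmul ξ η =>
    induction v with
    | zero => simp [rin_zero_right]
    | add v₁ v₂ h₁ h₂ => simp only [map_add, rin_add_right, h₁, h₂]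
    | tmul ξ' η' =>
      simp only [mulT, ampl, TensorProduct.map_tmul, TensorProduct.lift.tmul, X.rin_mul]
      exact congrArg (fun a => rin (X.A x) η (X.φ (quot h) a η')) (hTS ξ ξ')

theorem ampl_one (h : MorLE P f.1 g.1) (u : X.X f ⊗[ℂ] X.X (quot h)) : X.ampl h 1 u = u := by
  have : X.ampl h 1 = LinearMap.id := TensorProduct.map_id
  rw [this]; rfl

theorem norm_mulT_ampl_le (h : MorLE P f.1 g.1) (T : X.L f) (u : X.X f ⊗[ℂ] X.X (quot h)) :
    ‖X.mulT h (X.ampl h T u)‖ ≤ ‖T‖ * ‖X.mulT h u‖ := by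
  obtain ⟨C, hC⟩ := T.exists_compl
  have key : rin (X.A x) (X.mulT h (X.ampl h T u)) (X.mulT h (X.ampl h T u)) ≤
      ((‖T‖ : ℂ) ^ 2) • rin (X.A x) (X.mulT h u) (X.mulT h u) := by
    have e1 := X.rin_mulT_ampl h 1 (star T * T) T T (fun ξ η => by
      change rin (X.A y) ξ (star T (T η)) = _
      rw [rin_star_right]) u u
    have e2 := X.rin_mulT_ampl h 1 (star C * C) C C (fun ξ η => by
      change rin (X.A y) ξ (star C (C η)) = _
      rw [rin_star_right]) u u
    have e3 : X.ampl h (star T * T) u + X.ampl h (star C * C) u = ((‖T‖ : ℂ) ^ 2) • u := by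
      have : X.ampl h (star T * T) + X.ampl h (star C * C) =
          X.ampl h (star T * T + star C * C) := (TensorProduct.map_add_left _ _ _).symm
      rw [← LinearMap.add_apply, this, hC]
      have : X.ampl h (algebraMap ℂ _ ((‖T‖ : ℂ) ^ 2)) = ((‖T‖ : ℂ) ^ 2) • X.ampl h 1 := by
        rw [Algebra.algebraMap_eq_smul_one]
        exact TensorProduct.map_smul_left _ _ _
      rw [this, LinearMap.smul_apply, ampl_one]
    have e4 : rin (X.A x) (X.mulT h (X.ampl h T u)) (X.mulT h (X.ampl h T u)) +
        rin (X.A x) (X.mulT h (X.ampl h C u)) (X.mulT h (X.ampl h C u)) =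
        ((‖T‖ : ℂ) ^ 2) • rin (X.A x) (X.mulT h u) (X.mulT h u) := by
      rw [← e1, ← e2, ← rin_add_right, ← map_add, e3, ampl_one, map_smul, rin_smul_right]
    rw [← e4]
    exact le_add_of_nonneg_right (rin_self_nonneg _)
  refine le_of_sq_le_sq ?_ (by positivity)
  have := CStarAlgebra.norm_le_norm_of_nonneg_of_le (rin_self_nonneg _) key
  rw [norm_smul, ← norm_sq_rin, ← norm_sq_rin] at this
  simpa [mul_pow] using this

/-- The bounded operator on `X_g` with `ξη ↦ (Tξ)η` for `ξ ∈ X_f`, `η ∈ X_{f⁻¹g}`. -/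
def ellAux (h : MorLE P f.1 g.1) (T : X.L f) : X.X g →L[ℂ] X.X g :=
  (X.mulT h ∘ₗ X.ampl h T).extendOfNorm (X.mulT h)

theorem ellAux_mulT (h : MorLE P f.1 g.1) (T : X.L f) (u : X.X f ⊗[ℂ] X.X (quot h)) :
    X.ellAux h T (X.mulT h u) = X.mulT h (X.ampl h T u) :=
  LinearMap.extendOfNorm_eq (X.mul_dense _ _ _ _) ⟨‖T‖, X.norm_mulT_ampl_le h T⟩ u

theorem ellAux_adjoint (h : MorLE P f.1 g.1) (T : X.L f) :
    IsAdjointPair (X.A x) (X.ellAux h T) (X.ellAux h (star T)) := by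
  intro a b
  refine (X.mul_dense _ _ _ (quot_comp h)).induction_on₂
    (p := fun a b => rin (X.A x) (X.ellAux h T a) b = rin (X.A x) a (X.ellAux h (star T) b))
    ?_ ?_ a b
  · refine isClosed_eq ?_ ?_
    · exact continuous_rin.comp (((X.ellAux h T).continuous.comp continuous_fst).prodMk
        continuous_snd)
    · exact continuous_rin.comp (continuous_fst.prodMk
        ((X.ellAux h (star T)).continuous.comp continuous_snd))
  · intro u v
    change rin (X.A x) (X.ellAux h T (X.mulT h u)) (X.mulT h v) =
      rin (X.A x) (X.mulT h u) (X.ellAux h (star T) (X.mulT h v))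
    rw [ellAux_mulT, ellAux_mulT]
    have := X.rin_mulT_ampl h T 1 1 (star T) (fun ξ η => by
      change rin (X.A y) (T ξ) η = rin (X.A y) ξ (star T η)
      rw [rin_star_right]) u v
    rwa [ampl_one, ampl_one] at this

open Classical in
/-- The map `l^g_f : 𝓛(X_f) → 𝓛(X_g)`: if `f ≤ g`, then `l^g_f(T) = m (T ⊗ 1) m⋆` where
`m = m_{f, f⁻¹g}`, i.e. `l^g_f(T)(ξη) = (Tξ)η`; otherwise `l^g_f(T) = 0`. -/
def ell (f : PHom P y z) (g : PHom P x z) (T : X.L f) : X.L g :=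
  if h : MorLE P f.1 g.1 then ⟨X.ellAux h T, X.ellAux h (star T), X.ellAux_adjoint h T⟩ else 0

theorem ell_of_le (h : MorLE P f.1 g.1) (T : X.L f) :
    X.ell f g T = ⟨X.ellAux h T, X.ellAux h (star T), X.ellAux_adjoint h T⟩ := dif_pos h

theorem ell_of_not_le (h : ¬ MorLE P f.1 g.1) (T : X.L f) : X.ell f g T = 0 := dif_neg h

theorem ell_mul (h : MorLE P f.1 g.1) (T : X.L f) (ξ : X.X f) (η : X.X (quot h)) :
    X.ell f g T (X.mul (quot h) f g (quot_comp h) ξ η) =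
      X.mul (quot h) f g (quot_comp h) (T ξ) η := by
  rw [X.ell_of_le h]
  exact X.ellAux_mulT h T (ξ ⊗ₜ η)

theorem norm_ellAux_le (h : MorLE P f.1 g.1) (T : X.L f) : ‖X.ellAux h T‖ ≤ ‖T‖ :=
  LinearMap.opNorm_extendOfNorm_le (X.mul_dense _ _ _ _) (norm_nonneg _) (X.norm_mulT_ampl_le h T)

theorem norm_ell_le (f : PHom P y z) (g : PHom P x z) (T : X.L f) : ‖X.ell f g T‖ ≤ ‖T‖ := by
  by_cases h : MorLE P f.1 g.1
  · rw [X.ell_of_le h]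
    exact X.norm_ellAux_le h T
  · rw [X.ell_of_not_le h, norm_zero]
    exact norm_nonneg _

end ell

section tilde

variable {x y z : G}

/-- The kernel of `φ_f`. -/
def kerφ (f : PHom P x y) : Submodule ℂ (X.A y) where
  carrier := {a | X.φ f a = 0}
  add_mem' {a b} ha hb := by
    change X.φ f (a + b) = 0
    rw [map_add, show X.φ f a = 0 from ha, show X.φ f b = 0 from hb, add_zero]
  zero_mem' := map_zero _
  smul_mem' c a ha := by
    change X.φ f (c • a) = 0
    rw [map_smul, show X.φ f a = 0 from ha, smul_zero]

open Classical in
/-- The ideal `I_g` of `A_{t(g)}`: for `g ∈ P(x, y)` with `x = y` it is the intersection of the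
kernels of the `φ_f` over all `f ∈ P(-, y)` with `1_y < f ≤ g` (hence `A_y` if `g = 1_y`), and it is
`0` for `x ≠ y`. -/
def I (g : PHom P x y) : Submodule ℂ (X.A y) :=
  if x = y then
    ⨅ (f : PTo P y) (_ : PTo.one y < f) (_ : f ≤ ⟨x, g⟩), X.kerφ f.hom
  else ⊥

theorem I_mul_mem (g : PHom P x y) {a : X.A y} (ha : a ∈ X.I g) (b : X.A y) : a * b ∈ X.I g := by
  unfold I at *
  split_ifs at * with h
  · simp only [Submodule.mem_iInf] at *
    intro f h₁ h₂
    have : X.φ f.hom a = 0 := ha f h₁ h₂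
    change X.φ f.hom (a * b) = 0
    rw [map_mul, this, zero_mul]
  · rw [Submodule.mem_bot] at *
    rw [ha, zero_mul]

/-- The submodule `X_f I_k` of `X_f`, for `k ∈ P(w, s(f))`. -/
def fib (f : PHom P y z) (k : PHom P x y) : Submodule ℂ (X.X f) :=
  (Submodule.span ℂ {ζ : X.X f | ∃ ξ, ∃ a ∈ X.I k, ζ = ξ <• a}).topologicalClosure

theorem map_mem_fib (f : PHom P y z) (k : PHom P x y) (T : X.X f →L[ℂ] X.X f)
    (hT : ∀ ξ, ∀ a ∈ X.I k, T (ξ <• a) ∈ X.fib f k) {ζ : X.X f} (hζ : ζ ∈ X.fib f k) :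
    T ζ ∈ X.fib f k := by
  have h1 : Submodule.span ℂ {ζ : X.X f | ∃ ξ, ∃ a ∈ X.I k, ζ = ξ <• a} ≤
      (X.fib f k).comap (T : X.X f →ₗ[ℂ] X.X f) := by
    rw [Submodule.span_le]
    rintro _ ⟨ξ, a, ha, rfl⟩
    exact hT ξ a ha
  have h2 : IsClosed (((X.fib f k).comap (T : X.X f →ₗ[ℂ] X.X f) : Submodule ℂ (X.X f)) :
      Set (X.X f)) :=
    (Submodule.isClosed_topologicalClosure _).preimage T.continuous
  exact Submodule.topologicalClosure_minimal _ h1 h2 hζ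

theorem op_mem_fib (f : PHom P y z) (k : PHom P x y) (b : X.A y) {ζ : X.X f}
    (hζ : ζ ∈ X.fib f k) : ζ <• b ∈ X.fib f k := by
  refine X.map_mem_fib f k (rmul _ b) (fun ξ a ha => ?_) hζ
  refine Submodule.le_topologicalClosure _
    (Submodule.subset_span ⟨ξ, a * b, X.I_mul_mem k ha b, ?_⟩)
  exact ext_rin (X.A y) fun z => by simp only [rmul_apply, rin_op_right, _root_.mul_assoc]

theorem adjointable_mem_fib (f : PHom P y z) (k : PHom P x y) (T : X.L f) {ζ : X.X f}
    (hζ : ζ ∈ X.fib f k) : T ζ ∈ X.fib f k := by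
  refine X.map_mem_fib f k T.1 (fun ξ a ha => ?_) hζ
  refine Submodule.le_topologicalClosure _ (Submodule.subset_span ⟨T ξ, a, ha, ?_⟩)
  exact T.map_op ξ a

/-- The restriction of an adjointable operator on `X_f` to `X_f I_k`. -/
def restr (f : PHom P y z) (k : PHom P x y) (T : X.L f) : X.fib f k →ₗ[ℂ] X.fib f k :=
  LinearMap.restrict (T.1 : X.X f →ₗ[ℂ] X.X f) fun _ hζ => X.adjointable_mem_fib f k T hζ

/-- The set of all `f ∈ P(x, y)` with `f ≤ g`, for `g ∈ P(x, y)`. -/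
abbrev Below (g : PHom P x y) := {f : PHom P x y // MorLE P f.1 g.1}

/-- `C_c^g(X)`: the finitely supported families `(ξ(f))`, `f ∈ P(x, y)`, `f ≤ g`, with
`ξ(f) ∈ X_f I_{f⁻¹g}`. -/
def Cc (g : PHom P x y) : Type _ := Π₀ f : Below g, X.fib f.1 (quot f.2)

variable (g : PHom P x y)

instance : AddCommGroup (X.Cc g) :=
  inferInstanceAs (AddCommGroup (Π₀ f : Below g, X.fib f.1 (quot f.2)))

instance : Module ℂ (X.Cc g) :=
  inferInstanceAs (Module ℂ (Π₀ f : Below g, X.fib f.1 (quot f.2)))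

/-- The value `ξ(f) ∈ X_f`. -/
def Cc.val {X : ProductSystem.{u, v, w₁, w₂} P} {g : PHom P x y} (ξ : X.Cc g) (f : Below g) :
    X.X f.1 :=
  (DFinsupp.toFun ξ f : X.fib f.1 (quot f.2))

theorem Cc.ext {ξ η : X.Cc g} (h : ∀ f, ξ.val f = η.val f) : ξ = η :=
  DFinsupp.ext fun f => Subtype.ext (h f)

open Classical in
/-- The support of an element of `C_c^g(X)`. -/
def Cc.supp {X : ProductSystem.{u, v, w₁, w₂} P} {g : PHom P x y} (ξ : X.Cc g) :
    Finset (Below g) := DFinsupp.support ξ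

theorem Cc.val_eq_zero {ξ : X.Cc g} {f : Below g} (h : f ∉ ξ.supp) : ξ.val f = 0 := by
  classical
  have : DFinsupp.toFun ξ f = 0 := by
    by_contra h'
    exact h (DFinsupp.mem_support_iff.2 h')
  rw [Cc.val, this]; rfl

theorem Cc.val_zero (f : Below g) : (0 : X.Cc g).val f = 0 := rfl

theorem Cc.val_add (ξ η : X.Cc g) (f : Below g) : (ξ + η).val f = ξ.val f + η.val f := rfl

theorem Cc.val_smul (c : ℂ) (ξ : X.Cc g) (f : Below g) : (c • ξ).val f = c • ξ.val f := rfl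

/-- The right action `(ξ · a)(f) = ξ(f) a`. -/
instance : SMul (X.A x)ᵐᵒᵖ (X.Cc g) where
  smul a ξ := DFinsupp.mapRange
    (fun f (ζ : X.fib f.1 (quot f.2)) =>
      (⟨ζ.1 <• a.unop, X.op_mem_fib f.1 _ a.unop ζ.2⟩ : X.fib f.1 (quot f.2)))
    (fun _ => Subtype.ext (map_zero (rmul _ a.unop))) ξ

theorem Cc.val_op (ξ : X.Cc g) (a : X.A x) (f : Below g) : (ξ <• a).val f = ξ.val f <• a := rfl

/-- The inner product `⟨ξ, η⟩ = ∑ ⟨ξ(f), η(f)⟩`. -/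
instance : Inner (X.A x)ᵐᵒᵖ (X.Cc g) where
  inner ξ η := op (∑ f ∈ ξ.supp, rin (X.A x) (ξ.val f) (η.val f))

theorem Cc.rin_def (ξ η : X.Cc g) :
    rin (X.A x) ξ η = ∑ f ∈ ξ.supp, rin (X.A x) (ξ.val f) (η.val f) := rfl

theorem Cc.rin_eq_sum {ξ : X.Cc g} (η : X.Cc g) {s : Finset (Below g)} (hs : ξ.supp ⊆ s) :
    rin (X.A x) ξ η = ∑ f ∈ s, rin (X.A x) (ξ.val f) (η.val f) :=
  Finset.sum_subset hs fun f _ hf => by rw [Cc.val_eq_zero X g hf, rin_zero_left]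

/-- The norm `‖ξ‖ = ‖⟨ξ, ξ⟩‖^{1/2}`. -/
instance : Norm (X.Cc g) := CStarModule.norm (X.A x)ᵐᵒᵖ

theorem Cc.rin_star (ξ η : X.Cc g) : star (rin (X.A x) ξ η) = rin (X.A x) η ξ := by
  classical
  rw [Cc.rin_eq_sum X g η (Finset.subset_union_left (s₂ := η.supp)),
    Cc.rin_eq_sum X g ξ (Finset.subset_union_right (s₁ := ξ.supp)), star_sum]
  simp only [star_rin]

theorem Cc.rin_nonneg (ξ : X.Cc g) : 0 ≤ rin (X.A x) ξ ξ := by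
  rw [Cc.rin_def]
  exact Finset.sum_nonneg fun f _ => rin_self_nonneg _

theorem Cc.rin_eq_zero {ξ : X.Cc g} : rin (X.A x) ξ ξ = 0 ↔ ξ = 0 := by
  constructor
  · intro h
    rw [Cc.rin_def, Finset.sum_eq_zero_iff_of_nonneg fun f _ => rin_self_nonneg _] at h
    refine Cc.ext X g fun f => ?_
    by_cases hf : f ∈ ξ.supp
    · exact rin_self_eq_zero.1 (h f hf)
    · exact Cc.val_eq_zero X g hf
  · rintro rfl
    rw [Cc.rin_def]
    exact Finset.sum_eq_zero fun f _ => by rw [Cc.val_zero, rin_zero_left]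

instance : CStarModule (X.A x)ᵐᵒᵖ (X.Cc g) where
  inner_add_right {ξ η ζ} := unop_injective <| by
    change rin (X.A x) ξ (η + ζ) = rin (X.A x) ξ η + rin (X.A x) ξ ζ
    simp only [Cc.rin_def, Cc.val_add, rin_add_right, Finset.sum_add_distrib]
  inner_self_nonneg {ξ} := Cc.rin_nonneg X g ξ
  inner_self {ξ} := (unop_eq_zero_iff _).symm.trans (Cc.rin_eq_zero X g)
  inner_op_smul_right {a ξ η} := unop_injective <| by
    change rin (X.A x) ξ (η <• a.unop) = rin (X.A x) ξ η * a.unop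
    simp only [Cc.rin_def, Cc.val_op, rin_op_right, Finset.sum_mul]
  inner_smul_right_complex {c ξ η} := unop_injective <| by
    change rin (X.A x) ξ (c • η) = c • rin (X.A x) ξ η
    simp only [Cc.rin_def, Cc.val_smul, rin_smul_right, Finset.smul_sum]
  star_inner ξ η := unop_injective (Cc.rin_star X g ξ η)
  norm_eq_sqrt_norm_inner_self _ := rfl

instance : NormedAddCommGroup (X.Cc g) := CStarModule.normedAddCommGroup (X.A x)ᵐᵒᵖ

instance : NormedSpace ℂ (X.Cc g) := .ofCore (CStarModule.normedSpaceCore (X.A x)ᵐᵒᵖ)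

/-- The completion `X̃_g` of `C_c^g(X)`. -/
abbrev Xtilde := UniformSpace.Completion (X.Cc g)

/-- The operator `(Tξ)(f) = T_f(ξ(f))` on `C_c^g(X)`. -/
def diagₗ (T : ∀ f : Below g, X.L f.1) : X.Cc g →ₗ[ℂ] X.Cc g :=
  DFinsupp.mapRange.linearMap fun f => X.restr f.1 (quot f.2) (T f)

theorem val_diagₗ (T : ∀ f : Below g, X.L f.1) (ξ : X.Cc g) (f : Below g) :
    (X.diagₗ g T ξ).val f = T f (ξ.val f) := rfl

theorem norm_diagₗ_le (T : ∀ f : Below g, X.L f.1) (C : ℝ) (hC₀ : 0 ≤ C) (hC : ∀ f, ‖T f‖ ≤ C)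
    (ξ : X.Cc g) : ‖X.diagₗ g T ξ‖ ≤ C * ‖ξ‖ := by
  have hs : (X.diagₗ g T ξ).supp ⊆ ξ.supp := by
    classical exact DFinsupp.support_mapRange (hf := fun f => map_zero (X.restr f.1 _ (T f)))
  have key : rin (X.A x) (X.diagₗ g T ξ) (X.diagₗ g T ξ) ≤ (C ^ 2) • rin (X.A x) ξ ξ := by
    rw [Cc.rin_eq_sum X g _ hs, Cc.rin_def X g ξ ξ, Finset.smul_sum]
    refine Finset.sum_le_sum fun f _ => ?_
    rw [val_diagₗ]
    refine ((T f).rin_apply_le _).trans ?_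
    have e : ((‖T f‖ : ℂ) ^ 2) • rin (X.A x) (ξ.val f) (ξ.val f) =
        (‖T f‖ ^ 2) • rin (X.A x) (ξ.val f) (ξ.val f) := by
      rw [← Complex.ofReal_pow]; exact Complex.coe_smul _ _
    rw [e]
    exact smul_le_smul_of_nonneg_right (by gcongr; exact hC f) (rin_self_nonneg _)
  refine le_of_sq_le_sq ?_ (by positivity)
  have := CStarAlgebra.norm_le_norm_of_nonneg_of_le (rin_self_nonneg _) key
  rw [norm_smul, ← norm_sq_rin, ← norm_sq_rin] at this
  simpa [mul_pow] using this

/-- The bounded operator on `X̃_g` that extends `(Tξ)(f) = T_f(ξ(f))`, for a bounded family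
`(T_f)`. -/
def diag (T : ∀ f : Below g, X.L f.1) (C : ℝ) (hC₀ : 0 ≤ C) (hC : ∀ f, ‖T f‖ ≤ C) :
    X.Xtilde g →L[ℂ] X.Xtilde g :=
  ((UniformSpace.Completion.toComplL (𝕜 := ℂ) (E := X.Cc g)).comp
    ((X.diagₗ g T).mkContinuous C (X.norm_diagₗ_le g T C hC₀ hC))).extend
    (UniformSpace.Completion.toComplL (𝕜 := ℂ) (E := X.Cc g))

theorem diag_coe (T : ∀ f : Below g, X.L f.1) (C : ℝ) (hC₀ : 0 ≤ C) (hC : ∀ f, ‖T f‖ ≤ C)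
    (ξ : X.Cc g) : X.diag g T C hC₀ hC (ξ : X.Xtilde g) = (X.diagₗ g T ξ : X.Cc g) :=
  ContinuousLinearMap.extend_eq _ UniformSpace.Completion.denseRange_coe
    (UniformSpace.Completion.isUniformInducing_coe _) ξ

/-- The map `l̃^g_f : 𝓛(X_f) → 𝓛(X̃_g)`, `(l̃^g_f(T)ξ)(h) = l^h_f(T)(ξ(h))`, for `f, g` in `P` with
the same target. -/
def ltilde (f : PHom P z y) (T : X.L f) : X.Xtilde g →L[ℂ] X.Xtilde g :=
  X.diag g (fun h => X.ell f h.1 T) ‖T‖ (norm_nonneg _) fun h => X.norm_ell_le f h.1 T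

/-- The left action `φ̃_g` of `A_{t(g)}` on `X̃_g`, `(φ̃_g(a)ξ)(h) = φ_h(a)(ξ(h))`. -/
def phitilde (a : X.A y) : X.Xtilde g →L[ℂ] X.Xtilde g :=
  X.diag g (fun h => X.φ h.1 a) ‖a‖ (norm_nonneg _)
    fun h => NonUnitalStarAlgHom.norm_apply_le (X.φ h.1) a

/-- `X` is `φ̃`-injective. -/
def IsTildeInjective : Prop :=
  ∀ (x y : G) (g : PHom P x y), Function.Injective (X.phitilde g)

end tilde

/-- `X` is compactly aligned: `S ∨ T = l^k_f(S) l^k_g(T)` is compact for all compact `S`, `T`,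
whenever `k = f ∨ g` is the least upper bound of `f`, `g` in `P`. -/
def IsCompactlyAligned : Prop :=
  ∀ (y : G) (f g k : PTo P y), IsLUB {f, g} k → ∀ S ∈ X.K f.hom, ∀ T ∈ X.K g.hom,
    X.ell f.hom k.hom S * X.ell g.hom k.hom T ∈ X.K k.hom

/-- A Toeplitz representation of `X` in the C⋆-algebra `D`. -/
structure ToeplitzRep (D : Type*) [NonUnitalCStarAlgebra D] where
  /-- the linear maps `ψ_f : X_f → D` -/
  ψ : ∀ {x y : G} (f : PHom P x y), X.X f →ₗ[ℂ] D
  /-- the `⋆`-homomorphisms `ψ_{1_x} : A_x → D` -/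
  hom : ∀ x : G, X.A x →⋆ₙₐ[ℂ] D
  hom_eq : ∀ (x : G) (a : X.A x), hom x a = ψ (PHom.one x) (X.unit x a)
  map_mul : ∀ {x y z : G} (f : PHom P x y) (g : PHom P y z) (k : PHom P x z)
    (h : f.1 ≫ g.1 = k.1) (β : X.X g) (ξ : X.X f), ψ g β * ψ f ξ = ψ k (X.mul f g k h β ξ)
  star_ψ_mul : ∀ {x y : G} (f : PHom P x y) (η ξ : X.X f),
    star (ψ f η) * ψ f ξ = hom x (rin (X.A x) η ξ)

namespace ToeplitzRep

variable {X} {D : Type*} [NonUnitalCStarAlgebra D] (ψ : X.ToeplitzRep D)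

section up

variable {x y : G} (f : PHom P x y)

/-- `∑ c_{ξ,η} (ξ, η) ↦ ∑ c_{ξ,η} θ_{ξ,η}`. -/
def thetaSum (X : ProductSystem.{u, v, w₁, w₂} P) {x y : G} (f : PHom P x y) :
    (X.X f × X.X f →₀ ℂ) →ₗ[ℂ] X.K f :=
  Finsupp.linearCombination ℂ fun p => ⟨theta (X.A x) p.1 p.2, theta_mem p.1 p.2⟩

/-- `∑ c_{ξ,η} (ξ, η) ↦ ∑ c_{ξ,η} ψ_f(ξ) ψ_f(η)⋆`. -/
def psiSum : (X.X f × X.X f →₀ ℂ) →ₗ[ℂ] D :=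
  Finsupp.linearCombination ℂ fun p => ψ.ψ f p.1 * star (ψ.ψ f p.2)

theorem thetaSum_dense : DenseRange (thetaSum X f) := by
  intro T
  rw [closure_subtype]
  refine closure_mono ?_ T.2
  intro S hS
  change S ∈ Submodule.span ℂ _ at hS
  have h : Submodule.span ℂ {T | ∃ ξ η, T = theta (X.A x) (E := X.X f) ξ η} ≤
      (LinearMap.range (thetaSum X f)).map (X.K f).subtype := by
    rw [Submodule.span_le]
    rintro _ ⟨ξ, η, rfl⟩
    exact ⟨_, ⟨Finsupp.single (ξ, η) 1, rfl⟩, by simp [thetaSum]⟩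
  obtain ⟨R, ⟨c, rfl⟩, rfl⟩ := h hS
  exact ⟨_, ⟨c, rfl⟩, rfl⟩

theorem map_op (ξ : X.X f) (a : X.A x) : ψ.ψ f (ξ <• a) = ψ.ψ f ξ * ψ.hom x a := by
  have h : (PHom.one (P := P) x).1 ≫ f.1 = f.1 := Category.id_comp _
  rw [ψ.hom_eq, ψ.map_mul (PHom.one x) f f h, X.mul_one]

/-- `ξ ⊗ d ↦ ψ_f(ξ) d`. -/
def tens : X.X f ⊗[ℂ] D →ₗ[ℂ] D := TensorProduct.lift ((LinearMap.mul ℂ D).comp (ψ.ψ f))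

theorem star_tens (T S T' S' : X.L f)
    (hTS : ∀ ξ η, rin (X.A x) (T ξ) (S η) = rin (X.A x) (T' ξ) (S' η)) (u v : X.X f ⊗[ℂ] D) :
    star (ψ.tens f (TensorProduct.map T.1.toLinearMap LinearMap.id u)) *
        ψ.tens f (TensorProduct.map S.1.toLinearMap LinearMap.id v) =
      star (ψ.tens f (TensorProduct.map T'.1.toLinearMap LinearMap.id u)) *
        ψ.tens f (TensorProduct.map S'.1.toLinearMap LinearMap.id v) := by
  induction u with
  | zero => simp
  | add u₁ u₂ h₁ h₂ => simp only [map_add, star_add, add_mul, h₁, h₂]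
  | tmul ξ d =>
    induction v with
    | zero => simp
    | add v₁ v₂ h₁ h₂ => simp only [map_add, mul_add, h₁, h₂]
    | tmul ξ' d' =>
      have e : ∀ ζ ζ' : X.X f, star (ψ.ψ f ζ * d) * (ψ.ψ f ζ' * d') =
          star d * ψ.hom x (rin (X.A x) ζ ζ') * d' := fun ζ ζ' => by
        rw [← ψ.star_ψ_mul, star_mul]
        simp only [_root_.mul_assoc]
      change star (ψ.ψ f (T ξ) * d) * (ψ.ψ f (S ξ') * d') =
        star (ψ.ψ f (T' ξ) * d) * (ψ.ψ f (S' ξ') * d')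
      rw [e, e, hTS]

theorem norm_tens_le (T : X.L f) (u : X.X f ⊗[ℂ] D) :
    ‖ψ.tens f (TensorProduct.map T.1.toLinearMap LinearMap.id u)‖ ≤ ‖T‖ * ‖ψ.tens f u‖ := by
  let _ := CStarAlgebra.spectralOrder D
  have _ := CStarAlgebra.spectralOrderedRing D
  obtain ⟨C, hC⟩ := T.exists_compl
  let R : X.L f → (X.X f ⊗[ℂ] D →ₗ[ℂ] X.X f ⊗[ℂ] D) := fun S =>
    TensorProduct.map S.1.toLinearMap LinearMap.id
  have hone : R 1 = LinearMap.id := TensorProduct.map_id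
  have e1 : star (ψ.tens f (R 1 u)) * ψ.tens f (R (star T * T) u) =
      star (ψ.tens f (R T u)) * ψ.tens f (R T u) := ψ.star_tens f 1 (star T * T) T T (fun ξ η => by
      change rin (X.A x) ξ (star T (T η)) = _
      rw [rin_star_right]) u u
  have e2 : star (ψ.tens f (R 1 u)) * ψ.tens f (R (star C * C) u) =
      star (ψ.tens f (R C u)) * ψ.tens f (R C u) := ψ.star_tens f 1 (star C * C) C C (fun ξ η => by
      change rin (X.A x) ξ (star C (C η)) = _
      rw [rin_star_right]) u u
  have e3 : R (star T * T) u + R (star C * C) u = ((‖T‖ : ℂ) ^ 2) • u := by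
    have : R (star T * T) + R (star C * C) = R (star T * T + star C * C) :=
      (TensorProduct.map_add_left _ _ _).symm
    rw [← LinearMap.add_apply, this, hC]
    have : R (algebraMap ℂ _ ((‖T‖ : ℂ) ^ 2)) = ((‖T‖ : ℂ) ^ 2) • R 1 := by
      rw [Algebra.algebraMap_eq_smul_one]
      exact TensorProduct.map_smul_left _ _ _
    rw [this, LinearMap.smul_apply, hone, LinearMap.id_apply]
  have e4 : star (ψ.tens f (R T u)) * ψ.tens f (R T u) +
      star (ψ.tens f (R C u)) * ψ.tens f (R C u) =
      ((‖T‖ : ℂ) ^ 2) • (star (ψ.tens f u) * ψ.tens f u) := by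
    rw [← e1, ← e2, ← mul_add, ← map_add, e3, hone, LinearMap.id_apply, map_smul,
      mul_smul_comm]
  have key : star (ψ.tens f (R T u)) * ψ.tens f (R T u) ≤
      ((‖T‖ : ℂ) ^ 2) • (star (ψ.tens f u) * ψ.tens f u) := by
    rw [← e4]
    exact le_add_of_nonneg_right (star_mul_self_nonneg _)
  have := CStarAlgebra.norm_le_norm_of_nonneg_of_le (star_mul_self_nonneg _) key
  rw [norm_smul, CStarRing.norm_star_mul_self, CStarRing.norm_star_mul_self] at this
  change ‖ψ.tens f (R T u)‖ ≤ _
  refine le_of_sq_le_sq ?_ (by positivity)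
  calc _ = ‖ψ.tens f (R T u)‖ * ‖ψ.tens f (R T u)‖ := sq _
    _ ≤ _ := this
    _ = _ := by simp; ring

theorem psiSum_mul (c : X.X f × X.X f →₀ ℂ) (ζ : X.X f) :
    ψ.psiSum f c * ψ.ψ f ζ = ψ.ψ f ((thetaSum X f c).1 ζ) := by
  induction c using Finsupp.induction_linear with
  | zero => simp [show (0 : X.L f) ζ = 0 from rfl]
  | add c₁ c₂ h₁ h₂ =>
    rw [map_add, add_mul, h₁, h₂, ← map_add, map_add (thetaSum X f)]
    rfl
  | single p r =>
    have h1 : ψ.psiSum f (Finsupp.single p r) = r • (ψ.ψ f p.1 * star (ψ.ψ f p.2)) :=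
      Finsupp.linearCombination_single _ _ _
    have h2 : thetaSum X f (Finsupp.single p r) =
      r • ⟨theta (X.A x) p.1 p.2, theta_mem p.1 p.2⟩ := Finsupp.linearCombination_single _ _ _
    have h3 : (thetaSum X f (Finsupp.single p r)).1 ζ = r • (p.1 <• rin (X.A x) p.2 ζ) := by
      rw [h2]; rfl
    rw [h1, h3, map_smul, map_op, ← ψ.star_ψ_mul, smul_mul_assoc, _root_.mul_assoc]

theorem psiSum_mul_tens (c : X.X f × X.X f →₀ ℂ) (u : X.X f ⊗[ℂ] D) :
    ψ.psiSum f c * ψ.tens f u =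
      ψ.tens f (TensorProduct.map (thetaSum X f c).1.1.toLinearMap LinearMap.id u) := by
  induction u with
  | zero => simp
  | add u₁ u₂ h₁ h₂ => simp only [map_add, mul_add, h₁, h₂]
  | tmul ξ d =>
    change ψ.psiSum f c * (ψ.ψ f ξ * d) = ψ.ψ f ((thetaSum X f c).1 ξ) * d
    rw [← _root_.mul_assoc, psiSum_mul]

theorem exists_tens_eq_star (c : X.X f × X.X f →₀ ℂ) : ∃ u, ψ.tens f u = star (ψ.psiSum f c) := by
  induction c using Finsupp.induction_linear with
  | zero => exact ⟨0, by simp⟩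
  | add c₁ c₂ h₁ h₂ =>
    obtain ⟨u₁, h₁⟩ := h₁
    obtain ⟨u₂, h₂⟩ := h₂
    exact ⟨u₁ + u₂, by rw [map_add, map_add, star_add, h₁, h₂]⟩
  | single p r =>
    refine ⟨star r • (p.2 ⊗ₜ star (ψ.ψ f p.1)), ?_⟩
    have h1 : ψ.psiSum f (Finsupp.single p r) = r • (ψ.ψ f p.1 * star (ψ.ψ f p.2)) :=
      Finsupp.linearCombination_single _ _ _
    rw [h1, map_smul, star_smul, star_mul, star_star]
    rfl

theorem norm_psiSum_le (c : X.X f × X.X f →₀ ℂ) : ‖ψ.psiSum f c‖ ≤ 1 * ‖thetaSum X f c‖ := by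
  obtain ⟨u, hu⟩ := ψ.exists_tens_eq_star f c
  have h1 := ψ.norm_tens_le f (thetaSum X f c).1 u
  rw [← psiSum_mul_tens, hu, CStarRing.norm_self_mul_star, norm_star] at h1
  rw [_root_.one_mul]
  rcases (norm_nonneg (ψ.psiSum f c)).eq_or_lt with h | h
  · rw [← h]; exact norm_nonneg _
  · exact le_of_mul_le_mul_right h1 h

/-- The map `ψ^{(f)} : 𝓚(X_f) → D` with `ψ^{(f)}(θ_{ξ,η}) = ψ_f(ξ) ψ_f(η)⋆`. -/
def up : X.K f →L[ℂ] D := (ψ.psiSum f).extendOfNorm (thetaSum X f)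

theorem up_theta (ξ η : X.X f) :
    ψ.up f ⟨theta (X.A x) ξ η, theta_mem ξ η⟩ = ψ.ψ f ξ * star (ψ.ψ f η) := by
  have := LinearMap.extendOfNorm_eq (thetaSum_dense f) ⟨1, ψ.norm_psiSum_le f⟩
    (Finsupp.single (ξ, η) 1)
  have h1 : ψ.psiSum f (Finsupp.single (ξ, η) 1) = ψ.ψ f ξ * star (ψ.ψ f η) :=
    (Finsupp.linearCombination_single _ _ _).trans (one_smul _ _)
  have h2 : thetaSum X f (Finsupp.single (ξ, η) 1) = ⟨theta (X.A x) ξ η, theta_mem ξ η⟩ :=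
    (Finsupp.linearCombination_single _ _ _).trans (one_smul _ _)
  rwa [h1, h2] at this

end up

/-- `ψ` is Nica covariant: for compact `S`, `T`, the product `ψ^{(f)}(S) ψ^{(g)}(T)` is
`ψ^{(f ∨ g)}(S ∨ T)` if `f ∨ g < ∞`, and `0` if `f ∨ g = ∞`, i.e. if `f` and `g` have different
targets or have no common upper bound in `P`. -/
structure IsNicaCovariant (hX : X.IsCompactlyAligned) : Prop where
  of_isLUB : ∀ (y : G) (f g k : PTo P y) (hk : IsLUB {f, g} k) (S : X.K f.hom) (T : X.K g.hom),
    ψ.up f.hom S * ψ.up g.hom T =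
      ψ.up k.hom ⟨X.ell f.hom k.hom S * X.ell g.hom k.hom T, hX y f g k hk S S.2 T T.2⟩
  of_not_bddAbove : ∀ (y : G) (f g : PTo P y), ¬ BddAbove {f, g} →
    ∀ (S : X.K f.hom) (T : X.K g.hom), ψ.up f.hom S * ψ.up g.hom T = 0
  of_ne : ∀ (y z : G), y ≠ z → ∀ (f : PTo P y) (g : PTo P z) (S : X.K f.hom) (T : X.K g.hom),
    ψ.up f.hom S * ψ.up g.hom T = 0

/-- The statement `p g` is true for large `g ∈ P(-, y)`. -/
def ForLarge {y : G} (p : PTo P y → Prop) : Prop :=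
  ∀ f : PTo P y, ∃ h : PTo P y, f ≤ h ∧ ∀ g, h ≤ g → p g

/-- `ψ` is Cuntz-Pimsner covariant. The notion is defined for `φ̃`-injective product systems only, so
`φ̃`-injectivity is part of it. -/
structure IsCuntzPimsnerCovariant : Prop where
  tildeInjective : X.IsTildeInjective
  sum_eq_zero : ∀ (y : G) (F : Finset (PTo P y)) (T : ∀ f : PTo P y, X.K f.hom),
    ForLarge (fun g : PTo P y => ∑ f ∈ F, X.ltilde g.hom f.hom (T f) = 0) →
    ∑ f ∈ F, ψ.up f.hom (T f) = 0

/-- `ψ` is Cuntz-Nica-Pimsner covariant. -/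
structure IsCNPCovariant (hX : X.IsCompactlyAligned) : Prop where
  nica : ψ.IsNicaCovariant hX
  cuntzPimsner : ψ.IsCuntzPimsnerCovariant

end ToeplitzRep

end ProductSystem

end ProdSys

end

open ProdSys

/-! Write `L_ξ : ζ ↦ ξζ` for the creation operator of `ξ ∈ X_f` and `q = f⁻¹k` for `f ≤ k`. The
theorem rests on comparing `ψ^{(f)}` with `ψ^{(k)}` along `l^k_f`.

If `ψ` is CNP-covariant, then `l^g_f(φ_f(a)) = φ_g(a) = l^g_1(φ_1(a))` for all `g ≥ f` (`ell_φ`). So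
the family with `φ_1(a)` at `1_y` and `-φ_f(a)` at `f` is annihilated for large `g`, because every
`f₀` has an upper bound in common with `f`. Cuntz–Pimsner covariance yields `ψ^{(f)}(φ_f(a)) =
ψ^{(1)}(φ_1(a))`, and the right side is always `ψ_1(a)` (`up_one_φ`).

Conversely, `l^k_f(θ_{ξa,η}) = L_ξ φ_q(a) L_η⋆` (`sandwich_φ`). Hence `l^k_f` preserves compactness,
since `φ_q(a)` is compact (`ell_mem`), and `ψ^{(k)}` sends this operator to `ψ_f(ξ) ψ^{(q)}(φ_q(a))
ψ_f(η)⋆` (`up_sandwich`). If `ψ^{(q)} ∘ φ_q` is the representation of the coefficient algebra, the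
result is `ψ^{(f)}(θ_{ξa,η})`. By density `ψ^{(k)} ∘ l^k_f = ψ^{(f)}` on compacts (`up_ellK`). Nica
covariance follows by moving both factors to `f ∨ g`, where `ψ^{(f ∨ g)}` is multiplicative;
Cuntz–Pimsner covariance follows by moving all summands to one large `k`. Factors with different
targets multiply to zero by orthogonality and nondegeneracy (`up_mul_up_eq_zero`).

The augmented modules disappear: injectivity of the left actions forces `I_q = 0` for `q ≠ 1`, so
only the summand `X_g` of `X̃_g` survives, and sums of `l̃` vanish exactly when those of `l` do
(`sum_ltilde_eq_zero_iff`). -/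

noncomputable section

namespace ProdSys

/-! ### Rank one and compact operators on a Hilbert module -/

section HilbertModule

variable {A E : Type*} [NonUnitalCStarAlgebra A] [PartialOrder A] [StarOrderedRing A]
  [NormedAddCommGroup E] [NormedSpace ℂ E] [SMul Aᵐᵒᵖ E] [CStarModule Aᵐᵒᵖ E]

theorem op_op (x : E) (a b : A) : x <• a <• b = x <• (a * b) :=
  ext_rin A fun z => by simp only [rin_op_right, mul_assoc]

theorem norm_theta_le (ξ η : E) : ‖theta A ξ η‖ ≤ ‖ξ‖ * ‖η‖ :=
  ContinuousLinearMap.opNorm_le_bound _ (by positivity) fun ζ => by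
    calc ‖ξ <• rin A η ζ‖ ≤ ‖rin A η ζ‖ * ‖ξ‖ := norm_rmul_le _ _
      _ ≤ (‖η‖ * ‖ζ‖) * ‖ξ‖ := by gcongr; exact norm_rin_le _ _
      _ = _ := by ring

theorem mul_theta (T : Adjointable A E) (ξ η : E) : T * theta A ξ η = theta A (T ξ) η :=
  Subtype.ext <| ContinuousLinearMap.ext fun ζ => T.map_op ξ (rin A η ζ)

variable (A) in
/-- `ξ ↦ θ_{ξ,η}` as a bounded linear map. -/
def thetaLeft (η : E) : E →L[ℂ] Adjointable A E :=
  LinearMap.mkContinuous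
    { toFun := fun ξ => theta A ξ η
      map_add' := fun x y => Adjointable.ext' fun u v => by
        rw [Adjointable.add_apply, theta_apply, theta_apply, theta_apply, rin_add_right,
          rin_op_right, rin_op_right, rin_op_right, rin_add_right, add_mul]
      map_smul' := fun c x => Adjointable.ext' fun u v => by
        rw [RingHom.id_apply, Adjointable.smul_apply, theta_apply, theta_apply, rin_smul_right,
          rin_op_right, rin_op_right, rin_smul_right, smul_mul_assoc] }
    ‖η‖ fun ξ => (norm_theta_le ξ η).trans_eq (mul_comm _ _)

theorem compacts_le {W : Submodule ℂ (Adjointable A E)} (hW : IsClosed (W : Set (Adjointable A E)))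
    (h : ∀ ξ η, theta A ξ η ∈ W) : Compacts A E ≤ W :=
  Submodule.topologicalClosure_minimal _
    (Submodule.span_le.2 (by rintro _ ⟨ξ, η, rfl⟩; exact h ξ η)) hW

theorem isClosed_compacts : IsClosed (Compacts A E : Set (Adjointable A E)) :=
  Submodule.isClosed_topologicalClosure _

theorem mul_mem_compacts (S : Adjointable A E) {T : Adjointable A E} (hT : T ∈ Compacts A E) :
    S * T ∈ Compacts A E :=
  compacts_le (W := (Compacts A E).comap (LinearMap.mulLeft ℂ S))
    (isClosed_compacts.preimage (continuous_const_mul S))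
    (fun ξ η => by
      rw [Submodule.mem_comap, LinearMap.mulLeft_apply, mul_theta]
      exact theta_mem _ _) hT

/-- The form in which density arguments are run below: `W` is the locus where a bounded linear
identity holds, and `s` consists of the vectors `ξa` or `φ(a)ξ`. -/
theorem eq_top_of_isClosed_of_span {W : Submodule ℂ E} (hW : IsClosed (W : Set E)) {s : Set E}
    (hs : (Submodule.span ℂ s).topologicalClosure = ⊤) (h : s ⊆ W) : W = ⊤ :=
  top_le_iff.1 (hs ▸ Submodule.topologicalClosure_minimal _ (Submodule.span_le.2 h) hW)

end HilbertModule

/-! ### Total sets in the modules and in the compact operators -/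

namespace ProductSystem

variable {G : Type u} [Groupoid.{v} G] {P : MorphismProperty G} [P.IsMultiplicative]
  (X : ProductSystem.{u, v, w₁, w₂} P)

/-- The multiplication `X_f ⊗ X_{1_x} → X_f` is `ξ ⊗ b ↦ ξb` and has dense range, so no approximate
unit is needed. -/
theorem span_op_dense {x y : G} (f : PHom P x y) :
    (Submodule.span ℂ {ζ : X.X f | ∃ ξ : X.X f, ∃ a : X.A x, ζ = ξ <• a}).topologicalClosure =
      ⊤ := by
  rw [← Submodule.dense_iff_topologicalClosure_eq_top]
  have h : (PHom.one (P := P) x).1 ≫ f.1 = f.1 := Category.id_comp _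
  refine (X.mul_dense _ _ _ h).mono ?_
  rintro _ ⟨u, rfl⟩
  induction u with
  | zero => rw [map_zero]; exact zero_mem _
  | add u v hu hv => rw [map_add]; exact add_mem hu hv
  | tmul ξ b =>
    refine Submodule.subset_span ⟨ξ, (X.unit x).symm b, ?_⟩
    rw [← X.mul_one f h, LinearEquiv.apply_symm_apply, TensorProduct.lift.tmul]

theorem ext_K {x y : G} {f : PHom P x y} {V : Type*} [NormedAddCommGroup V] [NormedSpace ℂ V]
    {Φ Ψ : X.K f →L[ℂ] V}
    (h : ∀ ξ η, Φ ⟨theta (X.A x) ξ η, theta_mem ξ η⟩ = Ψ ⟨theta (X.A x) ξ η, theta_mem ξ η⟩) :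
    Φ = Ψ := by
  refine DFunLike.coe_injective
    ((ToeplitzRep.thetaSum_dense (X := X) f).equalizer Φ.continuous Ψ.continuous ?_)
  refine congrArg DFunLike.coe (?_ : Φ.toLinearMap ∘ₗ ToeplitzRep.thetaSum X f =
    Ψ.toLinearMap ∘ₗ ToeplitzRep.thetaSum X f)
  refine Finsupp.lhom_ext fun p c => ?_
  simp only [ToeplitzRep.thetaSum, LinearMap.comp_apply, Finsupp.linearCombination_single,
    map_smul]
  exact congrArg (c • ·) (h p.1 p.2)

/-! ### Creation and annihilation operators -/

section mul

variable {x y z : G} (q : PHom P x y) (f : PHom P y z) (k : PHom P x z) (h : q.1 ≫ f.1 = k.1)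

include h in
theorem eq_of_eq_mul {S T : X.L k}
    (hST : ∀ ξ η, S (X.mul q f k h ξ η) = T (X.mul q f k h ξ η)) : S = T := by
  refine Subtype.ext (DFunLike.coe_injective
    ((X.mul_dense q f k h).equalizer S.1.continuous T.1.continuous ?_))
  refine congrArg DFunLike.coe (?_ : S.1.toLinearMap ∘ₗ TensorProduct.lift (X.mul q f k h) =
    T.1.toLinearMap ∘ₗ TensorProduct.lift (X.mul q f k h))
  exact TensorProduct.ext' hST

/-- The creation operator `ζ ↦ ξζ`. -/
def creation (ξ : X.X f) : X.X q →L[ℂ] X.X k :=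
  (X.mul q f k h ξ).mkContinuous ‖ξ‖ fun ζ => by
    refine le_of_sq_le_sq ?_ (by positivity)
    rw [norm_sq_rin (A := X.A x), X.rin_mul]
    calc _ ≤ ‖ζ‖ * (‖X.φ q (rin (X.A y) ξ ξ)‖ * ‖ζ‖) :=
          (norm_rin_le _ _).trans (by gcongr; exact Adjointable.norm_apply_le _ _)
      _ ≤ ‖ζ‖ * (‖rin (X.A y) ξ ξ‖ * ‖ζ‖) := by
          gcongr; exact NonUnitalStarAlgHom.norm_apply_le _ _
      _ = _ := by rw [← norm_sq_rin]; ring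

theorem creation_apply (ξ : X.X f) (ζ : X.X q) : X.creation q f k h ξ ζ = X.mul q f k h ξ ζ := rfl

theorem norm_creation_le (ξ : X.X f) : ‖X.creation q f k h ξ‖ ≤ ‖ξ‖ :=
  LinearMap.mkContinuous_norm_le _ (norm_nonneg _) _

/-- `ζ ⊗ ζ' ↦ φ(⟨η, ζ⟩)ζ'` on the algebraic tensor product. -/
def annihilationT (η : X.X f) : X.X f ⊗[ℂ] X.X q →ₗ[ℂ] X.X q :=
  TensorProduct.lift <| LinearMap.mk₂ ℂ (fun ζ ζ' => X.φ q (rin (X.A y) η ζ) ζ')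
    (fun ζ₁ ζ₂ ζ' => by rw [rin_add_right, map_add]; rfl)
    (fun c ζ ζ' => by rw [rin_smul_right, map_smul]; rfl)
    (fun ζ ζ₁ ζ₂ => map_add (X.φ q (rin (X.A y) η ζ)).1 ζ₁ ζ₂)
    (fun c ζ ζ' => map_smul (X.φ q (rin (X.A y) η ζ)).1 c ζ')

/-- Adjointness to `L_η`, needed already on the algebraic tensor product: it supplies the bound
through which the annihilation operator descends to `X_k`. -/
theorem rin_annihilationT (η : X.X f) (w : X.X q) (u : X.X f ⊗[ℂ] X.X q) :
    rin (X.A x) w (X.annihilationT q f η u) =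
      rin (X.A x) (X.mul q f k h η w) (TensorProduct.lift (X.mul q f k h) u) := by
  induction u with
  | zero => simp only [map_zero, rin_zero_right]
  | add u v hu hv => simp only [map_add, rin_add_right, hu, hv]
  | tmul ζ ζ' => rw [TensorProduct.lift.tmul, X.rin_mul]; rfl

/-- With `w = L_η⋆ v` one has `‖w‖² = ‖⟨L_η w, v⟩‖ ≤ ‖η‖ ‖w‖ ‖v‖`; then `‖w‖` is cancelled. -/
theorem norm_annihilationT_le (η : X.X f) (u : X.X f ⊗[ℂ] X.X q) :
    ‖X.annihilationT q f η u‖ ≤ ‖η‖ * ‖TensorProduct.lift (X.mul q f k h) u‖ := by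
  set w := X.annihilationT q f η u with hw
  have key : ‖w‖ * ‖w‖ ≤ (‖η‖ * ‖TensorProduct.lift (X.mul q f k h) u‖) * ‖w‖ := by
    rw [← sq, norm_sq_rin (A := X.A x)]
    nth_rewrite 2 [hw]
    rw [X.rin_annihilationT q f k h]
    calc _ ≤ ‖X.creation q f k h η w‖ * _ := norm_rin_le _ _
      _ ≤ (‖η‖ * ‖w‖) * _ := by
          gcongr
          exact (X.creation q f k h η).le_of_opNorm_le (X.norm_creation_le q f k h η) w
      _ = _ := by ring
  rcases (norm_nonneg w).eq_or_lt with h0 | h0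
  · rw [← h0]; positivity
  · exact le_of_mul_le_mul_right key h0

/-- The annihilation operator `ζζ' ↦ φ(⟨η, ζ⟩)ζ'`. -/
def annihilation (η : X.X f) : X.X k →L[ℂ] X.X q :=
  (X.annihilationT q f η).extendOfNorm (TensorProduct.lift (X.mul q f k h))

theorem annihilation_lift (η : X.X f) (u : X.X f ⊗[ℂ] X.X q) :
    X.annihilation q f k h η (TensorProduct.lift (X.mul q f k h) u) = X.annihilationT q f η u :=
  LinearMap.extendOfNorm_eq (X.mul_dense q f k h) ⟨‖η‖, X.norm_annihilationT_le q f k h η⟩ u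

theorem annihilation_mul (η ζ : X.X f) (ζ' : X.X q) :
    X.annihilation q f k h η (X.mul q f k h ζ ζ') = X.φ q (rin (X.A y) η ζ) ζ' :=
  X.annihilation_lift q f k h η (ζ ⊗ₜ ζ')

theorem norm_annihilation_le (η : X.X f) : ‖X.annihilation q f k h η‖ ≤ ‖η‖ :=
  LinearMap.opNorm_extendOfNorm_le (X.mul_dense q f k h) (norm_nonneg _)
    (X.norm_annihilationT_le q f k h η)

theorem rin_annihilation (η : X.X f) (w : X.X q) (v : X.X k) :
    rin (X.A x) w (X.annihilation q f k h η v) = rin (X.A x) (X.creation q f k h η w) v := by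
  refine (X.mul_dense q f k h).induction_on
    (p := fun v => rin (X.A x) w (X.annihilation q f k h η v) =
      rin (X.A x) (X.creation q f k h η w) v) v ?_ fun u => ?_
  · exact isClosed_eq
      (continuous_rin.comp (continuous_const.prodMk (X.annihilation q f k h η).continuous))
      (continuous_rin.comp (continuous_const.prodMk continuous_id))
  · rw [annihilation_lift]
    exact X.rin_annihilationT q f k h η w u

theorem rin_annihilation_left (η : X.X f) (v : X.X k) (w : X.X q) :
    rin (X.A x) (X.annihilation q f k h η v) w = rin (X.A x) v (X.creation q f k h η w) := by
  rw [← star_rin, rin_annihilation, star_rin]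

theorem isAdjointPair_sandwich (ξ η : X.X f) (R : X.L q) :
    IsAdjointPair (X.A x)
      (X.creation q f k h ξ ∘L R.1 ∘L X.annihilation q f k h η)
      (X.creation q f k h η ∘L (star R).1 ∘L X.annihilation q f k h ξ) := fun u v => by
  change rin (X.A x) (X.creation q f k h ξ (R (X.annihilation q f k h η u))) v =
    rin (X.A x) u (X.creation q f k h η (star R (X.annihilation q f k h ξ v)))
  rw [← rin_annihilation, ← rin_annihilation_left, rin_star_right]

/-- `R ↦ L_ξ R L_η⋆`, where `L_ξ` is the creation operator `ζ ↦ ξζ`. -/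
def sandwich (ξ η : X.X f) : X.L q →L[ℂ] X.L k :=
  LinearMap.mkContinuous
    { toFun := fun R => ⟨_, _, X.isAdjointPair_sandwich q f k h ξ η R⟩
      map_add' := fun R S => Subtype.ext <| ContinuousLinearMap.ext fun v =>
        map_add (X.creation q f k h ξ) _ _
      map_smul' := fun c R => Subtype.ext <| ContinuousLinearMap.ext fun v =>
        map_smul (X.creation q f k h ξ) _ _ }
    (‖ξ‖ * ‖η‖) fun R => by
      calc _ ≤ ‖X.creation q f k h ξ‖ * (‖R.1‖ * ‖X.annihilation q f k h η‖) :=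
            (ContinuousLinearMap.opNorm_comp_le _ _).trans
              (by gcongr; exact ContinuousLinearMap.opNorm_comp_le _ _)
        _ ≤ ‖ξ‖ * (‖R.1‖ * ‖η‖) := by
            gcongr
            · exact X.norm_creation_le q f k h ξ
            · exact X.norm_annihilation_le q f k h η
        _ = (‖ξ‖ * ‖η‖) * ‖R.1‖ := by ring

theorem sandwich_apply (ξ η : X.X f) (R : X.L q) (v : X.X k) :
    X.sandwich q f k h ξ η R v = X.mul q f k h ξ (R (X.annihilation q f k h η v)) := rfl

/-- Adjointness moves `L_η⋆` to the other side of the inner product: `ξα⟨β, L_η⋆ v⟩ = ξα⟨ηβ, v⟩`.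
This makes `R ↦ L_ξ R L_η⋆` preserve compactness and lets `ψ^{(k)}` be evaluated on its values. -/
theorem sandwich_theta (ξ η : X.X f) (α β : X.X q) :
    X.sandwich q f k h ξ η (theta (X.A x) α β) =
      theta (X.A x) (X.mul q f k h ξ α) (X.mul q f k h η β) :=
  Subtype.ext <| ContinuousLinearMap.ext fun v => by
    change X.mul q f k h ξ (α <• rin (X.A x) β (X.annihilation q f k h η v)) =
      X.mul q f k h ξ α <• rin (X.A x) (X.mul q f k h η β) v
    rw [X.mul_right, rin_annihilation, creation_apply]

theorem sandwich_mem (ξ η : X.X f) {R : X.L q} (hR : R ∈ X.K q) :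
    X.sandwich q f k h ξ η R ∈ X.K k :=
  compacts_le (W := (X.K k).comap (X.sandwich q f k h ξ η).toLinearMap)
    (isClosed_compacts.preimage (X.sandwich q f k h ξ η).continuous)
    (fun α β => by
      change X.sandwich q f k h ξ η _ ∈ X.K k
      rw [sandwich_theta]
      exact theta_mem _ _) hR

end mul

/-! ### The amplification maps `l^k_f` on compact operators -/

section ell

variable {x y z : G} {f : PHom P y z} {k : PHom P x z} (h : MorLE P f.1 k.1)

include h in
-- Products `ξη` are total in `X_k`, so the defining formula on them determines `l^k_f(T)`.
theorem ell_eq_iff {T : X.L f} {S : X.L k} : X.ell f k T = S ↔ ∀ ξ η,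
    S (X.mul (quot h) f k (quot_comp h) ξ η) = X.mul (quot h) f k (quot_comp h) (T ξ) η := by
  refine ⟨?_, fun hS => X.eq_of_eq_mul _ _ _ (quot_comp h) fun ξ η => ?_⟩
  · rintro rfl ξ η
    exact X.ell_mul h T ξ η
  · rw [X.ell_mul h, hS]

include h in
theorem ell_φ (a : X.A z) : X.ell f k (X.φ f a) = X.φ k a :=
  (X.ell_eq_iff h).2 fun ξ η => (X.mul_left _ _ _ _ a ξ η).symm

/-- On `ζζ'` the left side gives `ξ · φ(a)φ(⟨η,ζ⟩)ζ'`, and balancing moves `a⟨η,ζ⟩` to the right of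
`ξ`. The factor `a` matters: it places `φ(a)`, rather than the identity of `X_{f⁻¹k}`, in the
middle. -/
theorem sandwich_φ (ξ η : X.X f) (a : X.A y) :
    X.sandwich (quot h) f k (quot_comp h) ξ η (X.φ (quot h) a) =
      X.ell f k (theta (X.A y) (ξ <• a) η) :=
  ((X.ell_eq_iff h).2 fun ζ ζ' => by
    rw [sandwich_apply, annihilation_mul, theta_apply, op_op, X.mul_balanced, map_mul,
      Adjointable.mul_apply]).symm

/-- `l^k_f` as a bounded linear map, for `f ≤ k`. -/
def ellL (h : MorLE P f.1 k.1) : X.L f →L[ℂ] X.L k :=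
  LinearMap.mkContinuous
    { toFun := X.ell f k
      map_add' := fun S T => (X.ell_eq_iff h).2 fun ξ η => by
        rw [Adjointable.add_apply, X.ell_mul h, X.ell_mul h, Adjointable.add_apply, map_add,
          LinearMap.add_apply]
      map_smul' := fun c T => (X.ell_eq_iff h).2 fun ξ η => by
        rw [RingHom.id_apply, Adjointable.smul_apply, X.ell_mul h, Adjointable.smul_apply, map_smul,
          LinearMap.smul_apply] }
    1 fun T => (X.norm_ell_le f k T).trans_eq (_root_.one_mul _).symm

theorem ellL_apply (T : X.L f) : X.ellL h T = X.ell f k T := rfl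

include h in
-- By continuity it is enough to treat `θ_{ξa,η}`, since the `ξa` are total; its image is `L_ξ φ(a)
-- L_η⋆` with compact middle factor.
theorem ell_mem (hφ : ∀ a, X.φ (quot h) a ∈ X.K (quot h)) {T : X.L f} (hT : T ∈ X.K f) :
    X.ell f k T ∈ X.K k := by
  refine compacts_le (W := (X.K k).comap (X.ellL h).toLinearMap)
    (isClosed_compacts.preimage (X.ellL h).continuous) (fun ξ η => ?_) hT
  have := eq_top_of_isClosed_of_span
    (W := (X.K k).comap ((X.ellL h).comp (thetaLeft (X.A y) η)).toLinearMap)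
    (isClosed_compacts.preimage ((X.ellL h).comp (thetaLeft (X.A y) η)).continuous)
    (X.span_op_dense f) (by
      rintro _ ⟨ξ, a, rfl⟩
      change X.ell f k (theta (X.A y) (ξ <• a) η) ∈ X.K k
      rw [← X.sandwich_φ h]
      exact X.sandwich_mem _ _ _ _ _ _ (hφ a))
  exact (this ▸ Submodule.mem_top : ξ ∈ (X.K k).comap _)

/-- The restriction of `l^k_f` to compact operators, for `f ≤ k` such that `A` acts by compact
operators on `X_{f⁻¹k}`. -/
def ellK (h : MorLE P f.1 k.1) (hφ : ∀ a, X.φ (quot h) a ∈ X.K (quot h)) : X.K f →L[ℂ] X.K k :=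
  ((X.ellL h).comp (X.K f).subtypeL).codRestrict (X.K k) fun T => X.ell_mem h hφ T.2

end ell

/-! ### Toeplitz representations and the maps `ψ^{(f)}` -/

namespace ToeplitzRep

variable {X} {D : Type*} [NonUnitalCStarAlgebra D]
  (ψ : X.ToeplitzRep D)

theorem hom_mul_ψ {x y : G} (f : PHom P x y) (a : X.A y) (ξ : X.X f) :
    ψ.hom y a * ψ.ψ f ξ = ψ.ψ f (X.φ f a ξ) := by
  have h : f.1 ≫ (PHom.one (P := P) y).1 = f.1 := Category.comp_id _
  rw [ψ.hom_eq, ψ.map_mul f (PHom.one y) f h, X.one_mul]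

theorem norm_ψ_le {x y : G} (f : PHom P x y) (ξ : X.X f) : ‖ψ.ψ f ξ‖ ≤ ‖ξ‖ := by
  refine le_of_sq_le_sq ?_ (norm_nonneg _)
  rw [sq, ← CStarRing.norm_star_mul_self, ψ.star_ψ_mul, norm_sq_rin (A := X.A x)]
  exact NonUnitalStarAlgHom.norm_apply_le _ _

/-- `ψ_f` as a bounded linear map. -/
def ψL {x y : G} (f : PHom P x y) : X.X f →L[ℂ] D :=
  (ψ.ψ f).mkContinuous 1 fun ξ => (ψ.norm_ψ_le f ξ).trans_eq (_root_.one_mul _).symm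

theorem up_mul_ψ {x y : G} (f : PHom P x y) (S : X.K f) (ζ : X.X f) :
    ψ.up f S * ψ.ψ f ζ = ψ.ψ f (S.1 ζ) := by
  refine (thetaSum_dense f).induction_on
    (p := fun S => ψ.up f S * ψ.ψ f ζ = ψ.ψ f (S.1 ζ)) S ?_ fun c => ?_
  · refine isClosed_eq ((ψ.up f).continuous.mul_const _) ((ψ.ψL f).continuous.comp ?_)
    exact (ContinuousLinearMap.apply ℂ (X.X f) ζ).continuous.comp
      (continuous_subtype_val.comp continuous_subtype_val)
  · rw [← ψ.psiSum_mul]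
    exact congrArg (· * _)
      (LinearMap.extendOfNorm_eq (thetaSum_dense f) ⟨1, ψ.norm_psiSum_le f⟩ c)

/-- `ψ^{(f)}` was constructed only as a bounded linear map. Multiplicativity need only be tested on
`T = θ_{ξ,η}`, where `ψ^{(f)}(S)ψ_f(ξ) = ψ_f(Sξ)` and `Sθ_{ξ,η} = θ_{Sξ,η}`. -/
theorem up_mul_up {x y : G} (f : PHom P x y) (S T : X.K f) :
    ψ.up f S * ψ.up f T = ψ.up f ⟨S.1 * T.1, mul_mem_compacts S.1 T.2⟩ := by
  let M : X.K f →L[ℂ] X.K f := ((ContinuousLinearMap.mul ℂ (X.L f) S.1).comp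
    (X.K f).subtypeL).codRestrict (X.K f) fun T => mul_mem_compacts S.1 T.2
  refine congrArg (fun Φ : X.K f →L[ℂ] D => Φ T) (X.ext_K
    (Φ := (ContinuousLinearMap.mul ℂ D (ψ.up f S)).comp (ψ.up f)) (Ψ := (ψ.up f).comp M)
    fun ξ η => ?_)
  change ψ.up f S * ψ.up f _ = ψ.up f ⟨S.1 * theta (X.A x) ξ η, _⟩
  rw [up_theta, ← _root_.mul_assoc, up_mul_ψ, ← up_theta]
  exact congrArg (ψ.up f) (Subtype.ext (mul_theta _ _ _).symm)

/-- For `R = θ_{α,β}` both sides are `ψ_k(ξα) ψ_k(ηβ)⋆`; linearity and continuity in `R` do the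
rest. -/
theorem up_sandwich {x y z : G} (q : PHom P x y) (f : PHom P y z) (k : PHom P x z)
    (h : q.1 ≫ f.1 = k.1) (ξ η : X.X f) (R : X.K q) :
    ψ.up k ⟨X.sandwich q f k h ξ η R, X.sandwich_mem q f k h ξ η R.2⟩ =
      ψ.ψ f ξ * ψ.up q R * star (ψ.ψ f η) := by
  let M : X.K q →L[ℂ] X.K k := ((X.sandwich q f k h ξ η).comp
    (X.K q).subtypeL).codRestrict (X.K k) fun R => X.sandwich_mem q f k h ξ η R.2
  refine congrArg (fun Φ : X.K q →L[ℂ] D => Φ R) (X.ext_K (Φ := (ψ.up k).comp M)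
    (Ψ := ((ContinuousLinearMap.mul ℂ D).flip (star (ψ.ψ f η))).comp
      ((ContinuousLinearMap.mul ℂ D (ψ.ψ f ξ)).comp (ψ.up q))) fun α β => ?_)
  change ψ.up k ⟨X.sandwich q f k h ξ η (theta (X.A x) α β), _⟩ =
    ψ.ψ f ξ * ψ.up q ⟨theta (X.A x) α β, _⟩ * star (ψ.ψ f η)
  have e : ψ.up k ⟨X.sandwich q f k h ξ η (theta (X.A x) α β),
      X.sandwich_mem q f k h ξ η (theta_mem α β)⟩ = ψ.up k ⟨theta (X.A x) _ _, theta_mem _ _⟩ :=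
    congrArg (ψ.up k) (Subtype.ext (X.sandwich_theta q f k h ξ η α β))
  rw [e, up_theta, up_theta, ← ψ.map_mul q f k h, ← ψ.map_mul q f k h, star_mul]
  simp only [_root_.mul_assoc]

/-- The heart of the converse. On `θ_{ξa,η}` the left side is `ψ_f(ξ) ψ^{(q)}(φ_q(a)) ψ_f(η)⋆` with
`q = f⁻¹k`, and `hψ` turns the middle factor into `ψ_1(a)`, which is absorbed into `ψ_f(ξa)`. -/
theorem up_ellK {x y z : G} {f : PHom P y z} {k : PHom P x z} (h : MorLE P f.1 k.1)
    (hφ : ∀ a, X.φ (quot h) a ∈ X.K (quot h))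
    (hψ : ∀ a, ψ.up (quot h) ⟨X.φ (quot h) a, hφ a⟩ = ψ.hom y a) (S : X.K f) :
    ψ.up k (X.ellK h hφ S) = ψ.up f S := by
  refine congrArg (fun Φ : X.K f →L[ℂ] D => Φ S)
    (X.ext_K (Φ := (ψ.up k).comp (X.ellK h hφ)) (Ψ := ψ.up f) fun ξ η => ?_)
  -- With `η` fixed, both sides are bounded and linear in `ξ`, so `ξ` may be replaced by vectors
  -- `ξa`.
  let Θ : X.X f →L[ℂ] X.K f := (thetaLeft (X.A y) η).codRestrict (X.K f) fun ξ => theta_mem ξ η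
  let Φ : X.X f →L[ℂ] D := ((ψ.up k).comp (X.ellK h hφ)).comp Θ - (ψ.up f).comp Θ
  have hΦ : LinearMap.ker Φ.toLinearMap = ⊤ := by
    refine eq_top_of_isClosed_of_span Φ.isClosed_ker (X.span_op_dense f) ?_
    rintro _ ⟨ξ, a, rfl⟩
    change ψ.up k ⟨X.ell f k (theta (X.A y) (ξ <• a) η), _⟩ -
      ψ.up f ⟨theta (X.A y) (ξ <• a) η, _⟩ = 0
    have e : ψ.up k ⟨X.ell f k (theta (X.A y) (ξ <• a) η), X.ell_mem h hφ (theta_mem _ _)⟩ =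
        ψ.up k ⟨_, X.sandwich_mem _ _ _ (quot_comp h) ξ η (hφ a)⟩ :=
      congrArg (ψ.up k) (Subtype.ext (X.sandwich_φ h ξ η a).symm)
    rw [e, up_theta, ψ.up_sandwich _ _ _ (quot_comp h) ξ η ⟨_, hφ a⟩, hψ, map_op, sub_self]
  exact sub_eq_zero.1 (hΦ ▸ Submodule.mem_top : ξ ∈ LinearMap.ker Φ.toLinearMap)

/-- Under `X_{1_y} = A_y` left multiplication by `bc` is `θ_{b,c⋆}`, which `ψ^{(1)}` sends to
`ψ_1(b)ψ_1(c⋆)⋆ = ψ_1(bc)`. Products are total in `A_y`. -/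
theorem up_one_φ {y : G} (h : ∀ a, X.φ (PHom.one (P := P) y) a ∈ X.K (PHom.one y)) (a : X.A y) :
    ψ.up (PHom.one y) ⟨X.φ (PHom.one y) a, h a⟩ = ψ.hom y a := by
  have hmul : ∀ b c : X.A y, X.φ (PHom.one (P := P) y) (b * c) =
      theta (X.A y) (X.unit y b) (X.unit y (star c)) := fun b c => by
    refine Subtype.ext <| ContinuousLinearMap.ext fun ζ => ?_
    obtain ⟨d, rfl⟩ := (X.unit y).surjective ζ
    change X.φ (PHom.one y) (b * c) (X.unit y d) = X.unit y b <• rin (X.A y) _ (X.unit y d)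
    rw [X.rin_unit, ← X.unit_left, star_star, ← X.unit_right, _root_.mul_assoc]
  -- Pulling back along the identification `X_{1_y} → A_y` makes `span_op_dense` available as the
  -- totality of products.
  let U : X.X (PHom.one (P := P) y) →L[ℂ] X.A y :=
    (X.unit y).symm.toLinearMap.mkContinuous 1 fun ζ => by
      obtain ⟨d, rfl⟩ := (X.unit y).surjective ζ
      rw [LinearEquiv.coe_coe, LinearEquiv.symm_apply_apply, _root_.one_mul]
      refine le_of_sq_le_sq ?_ (norm_nonneg _)
      rw [norm_sq_rin (A := X.A y) (X.unit y d), X.rin_unit, CStarRing.norm_star_mul_self, sq]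
  let Φ : X.A y →L[ℂ] X.L (PHom.one (P := P) y) :=
    LinearMap.mkContinuous (X.φ (PHom.one y) : X.A y →ₗ[ℂ] X.L (PHom.one (P := P) y)) 1
      fun a => (NonUnitalStarAlgHom.norm_apply_le (X.φ (PHom.one y)) a).trans_eq
        (_root_.one_mul _).symm
  let Ψ : X.A y →L[ℂ] D := LinearMap.mkContinuous (ψ.hom y : X.A y →ₗ[ℂ] D) 1
      fun a => (NonUnitalStarAlgHom.norm_apply_le (ψ.hom y) a).trans_eq (_root_.one_mul _).symm
  -- A predicate, so that `a` can be rewritten together with the compactness proof depending on it.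
  let p : X.A y → Prop := fun a =>
    ψ.up (PHom.one y) ⟨X.φ (PHom.one y) a, h a⟩ = ψ.hom y a
  let Δ := ((ψ.up (PHom.one y)).comp (Φ.codRestrict (X.K (PHom.one y)) h) - Ψ).comp U
  have hΔ : LinearMap.ker Δ.toLinearMap = ⊤ := by
    refine eq_top_of_isClosed_of_span Δ.isClosed_ker (X.span_op_dense (PHom.one y)) ?_
    rintro _ ⟨ξ, c, rfl⟩
    obtain ⟨b, rfl⟩ := (X.unit y).surjective ξ
    have e : p (b * c) := by
      have e1 : ψ.up (PHom.one y) ⟨X.φ (PHom.one y) (b * c), h _⟩ =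
          ψ.up (PHom.one y) ⟨theta (X.A y) _ _, theta_mem _ _⟩ :=
        congrArg (ψ.up (PHom.one y)) (Subtype.ext (hmul b c))
      refine e1.trans ?_
      rw [up_theta, ← hom_eq, ← hom_eq, map_star, star_star, _root_.map_mul]
    rw [← (X.unit y).symm_apply_apply (b * c), X.unit_right] at e
    exact sub_eq_zero.2 e
  have : X.unit y a ∈ LinearMap.ker Δ.toLinearMap := hΔ ▸ Submodule.mem_top
  have e : p ((X.unit y).symm (X.unit y a)) := sub_eq_zero.1 this
  rwa [LinearEquiv.symm_apply_apply] at e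

/-- By nondegeneracy one may take `φ(a)η` and `φ(b)ξ`; the product then contains `ψ_1(a⋆)ψ_1(b) =
0`. -/
theorem star_ψ_mul_ψ_eq_zero {w x y z : G} (f : PHom P w y) (g : PHom P x z)
    (hyz : ∀ (a : X.A y) (b : X.A z), ψ.hom y a * ψ.hom z b = 0) (η : X.X f) (ξ : X.X g) :
    star (ψ.ψ f η) * ψ.ψ g ξ = 0 := by
  let Φ : X.X f → X.X g →L[ℂ] D := fun η =>
    (ContinuousLinearMap.mul ℂ D (star (ψ.ψ f η))).comp (ψ.ψL g)
  let Ψ : X.X g → X.X f →L[ℂ] D := fun ξ =>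
    (ContinuousLinearMap.mul ℂ D (star (ψ.ψ g ξ))).comp (ψ.ψL f)
  -- The product is conjugate linear in `η`, so the density argument in `η` is run on its adjoint,
  -- with the second vector already of the form `φ(b)ξ`.
  have h1 : ∀ (b : X.A z) (ξ : X.X g) (η : X.X f),
      star (ψ.ψ g (X.φ g b ξ)) * ψ.ψ f η = 0 := fun b ξ η => by
    have : LinearMap.ker (Ψ (X.φ g b ξ)).toLinearMap = ⊤ := by
      refine eq_top_of_isClosed_of_span (Ψ _).isClosed_ker (X.nondegenerate f) ?_
      rintro _ ⟨a, η, rfl⟩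
      change star (ψ.ψ g (X.φ g b ξ)) * ψ.ψ f (X.φ f a η) = 0
      rw [← hom_mul_ψ, ← hom_mul_ψ, star_mul, ← map_star (ψ.hom z), _root_.mul_assoc,
        ← _root_.mul_assoc (ψ.hom z _) (ψ.hom y _)]
      have : ψ.hom z (star b) * ψ.hom y a = 0 := by
        rw [← star_eq_zero, star_mul, ← map_star (ψ.hom y), ← map_star (ψ.hom z), hyz]
      rw [this, zero_mul, mul_zero]
    exact (this ▸ Submodule.mem_top : η ∈ LinearMap.ker (Ψ (X.φ g b ξ)).toLinearMap)
  have : LinearMap.ker (Φ η).toLinearMap = ⊤ := by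
    refine eq_top_of_isClosed_of_span (Φ η).isClosed_ker (X.nondegenerate g) ?_
    rintro _ ⟨b, ξ, rfl⟩
    change star (ψ.ψ f η) * ψ.ψ g (X.φ g b ξ) = 0
    rw [← star_eq_zero, star_mul, star_star, h1]
  exact (this ▸ Submodule.mem_top : ξ ∈ LinearMap.ker (Φ η).toLinearMap)

theorem up_mul_up_eq_zero {w x y z : G} (f : PHom P w y) (g : PHom P x z)
    (hyz : ∀ (a : X.A y) (b : X.A z), ψ.hom y a * ψ.hom z b = 0) (S : X.K f) (T : X.K g) :
    ψ.up f S * ψ.up g T = 0 := by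
  refine congrArg (fun Φ : X.K f →L[ℂ] D => Φ S) (X.ext_K
    (Φ := ((ContinuousLinearMap.mul ℂ D).flip (ψ.up g T)).comp (ψ.up f)) (Ψ := 0) fun ξ η => ?_)
  refine congrArg (fun Φ : X.K g →L[ℂ] D => Φ T) (X.ext_K
    (Φ := (ContinuousLinearMap.mul ℂ D (ψ.up f ⟨theta (X.A w) ξ η, theta_mem ξ η⟩)).comp
      (ψ.up g)) (Ψ := 0) fun ξ' η' => ?_)
  change ψ.up f _ * ψ.up g _ = 0
  rw [up_theta, up_theta, _root_.mul_assoc, ← _root_.mul_assoc (star _),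
    ψ.star_ψ_mul_ψ_eq_zero f g hyz, zero_mul, mul_zero]

end ToeplitzRep

/-! ### Collapse of the augmented modules `X̃_g` to `X_g` -/

section tilde

theorem morLE_refl {x y : G} (f : PHom P x y) : MorLE P f.1 f.1 := by
  simpa only [MorLE, Groupoid.comp_inv] using P.id_mem x

theorem quot_eq_one_iff {x y : G} {f g : PHom P x y} (h : MorLE P f.1 g.1) :
    quot h = PHom.one x ↔ f = g := by
  refine ⟨fun e => Subtype.ext ?_, ?_⟩
  · rw [← quot_comp h, e]
    exact (Category.id_comp _).symm
  · rintro rfl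
    exact Subtype.ext (Groupoid.comp_inv _)

theorem IsQuasiLatticeOrdered.eq_one (hP : IsQuasiLatticeOrdered P) {x : G} (q : PHom P x x)
    (hq : P (Groupoid.inv q.1)) : q = PHom.one x := by
  have : q.1 ∈ {f : x ⟶ x | P f ∧ P (Groupoid.inv f)} := ⟨q.2, hq⟩
  rw [hP.inter_inv] at this
  exact Subtype.ext this.2

theorem I_one (x : G) : X.I (PHom.one (P := P) x) = ⊤ := by
  rw [I, if_pos rfl]
  simp only [iInf_eq_top]
  exact fun f h₁ h₂ => (h₁.not_ge h₂).elim

/-- Since `1 < q`, the morphism `q` is itself one of the indices of the intersection, so `I_q ⊆ ker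
φ_q = 0`. -/
theorem I_eq_bot (hP : IsQuasiLatticeOrdered P) {x : G} (q : PHom P x x) (hq : q ≠ PHom.one x)
    (hinj : Function.Injective (X.φ q)) : X.I q = ⊥ := by
  rw [I, if_pos rfl, eq_bot_iff]
  -- Strictness uses `P ∩ P⁻¹ = {1}`: if also `q ≤ 1`, then `q⁻¹ ∈ P` and `q = 1`.
  have hlt : PTo.one x < (⟨x, q⟩ : PTo P x) := by
    refine lt_of_le_not_ge (one_morLE q) fun h => hq ?_
    refine IsQuasiLatticeOrdered.eq_one hP q ?_
    simpa [MorLE, PTo.one, PHom.one] using (show MorLE P q.1 (PHom.one (P := P) x).1 from h)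
  exact (iInf₂_le_of_le _ hlt (iInf_le _ le_rfl)).trans fun a ha =>
    (Submodule.mem_bot _).2 (hinj ((ha : X.φ q a = 0).trans (map_zero _).symm))

variable {x y : G} (g : PHom P x y)

theorem fib_self (h : MorLE P g.1 g.1) :
    X.fib g (quot h) = ⊤ := by
  rw [(quot_eq_one_iff h).2 rfl, fib, I_one X]
  simpa using X.span_op_dense g

theorem fib_eq_bot (hP : IsQuasiLatticeOrdered P) (f : PHom P x y) (h : MorLE P f.1 g.1)
    (hfg : f ≠ g) (hinj : Function.Injective (X.φ (quot h))) : X.fib f (quot h) = ⊥ := by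
  rw [fib, I_eq_bot X hP _ (fun e => hfg ((quot_eq_one_iff h).1 e)) hinj, eq_bot_iff]
  refine Submodule.topologicalClosure_minimal _ (Submodule.span_le.2 ?_) isClosed_singleton
  rintro _ ⟨ξ, a, ha, rfl⟩
  rw [(Submodule.mem_bot ℂ).1 ha]
  exact ext_rin (X.A x) fun z => by rw [rin_op_right, mul_zero, rin_zero_right]

/-- `g` as an element of `{f | f ≤ g}`. -/
def Below.top : Below g := ⟨g, morLE_refl g⟩

open Classical in
/-- The inclusion of `X_g` in `C_c^g(X)`. -/
def atTop : X.X g →ₗ[ℂ] X.Cc g :=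
  (DFinsupp.lsingle (M := fun f : Below g => X.fib f.1 (quot f.2)) (Below.top g) :
      X.fib g (quot (morLE_refl g)) →ₗ[ℂ] Π₀ f : Below g, X.fib f.1 (quot f.2)) ∘ₗ
    (LinearMap.id.codRestrict (X.fib g (quot (morLE_refl g))) fun _ =>
      (X.fib_self g (morLE_refl g)).symm ▸ Submodule.mem_top)

theorem val_atTop (ζ : X.X g) : (X.atTop g ζ).val (Below.top g) = ζ := by
  classical
  exact congrArg Subtype.val (DFinsupp.single_eq_same
    (β := fun f : Below g => X.fib f.1 (quot f.2)) (i := Below.top g))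

theorem val_atTop_of_ne (ζ : X.X g) {f : Below g} (hf : f ≠ Below.top g) :
    (X.atTop g ζ).val f = 0 := by
  classical
  exact congrArg Subtype.val (DFinsupp.single_eq_of_ne
    (β := fun f : Below g => X.fib f.1 (quot f.2)) hf)

theorem diagₗ_atTop (T : ∀ f : Below g, X.L f.1) (ζ : X.X g) :
    X.diagₗ g T (X.atTop g ζ) = X.atTop g (T (Below.top g) ζ) := by
  refine Cc.ext X g fun f => ?_
  rw [val_diagₗ]
  by_cases hf : f = Below.top g
  · subst hf
    exact (congrArg (T (Below.top g)) (X.val_atTop g ζ)).trans (X.val_atTop g _).symm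
  · rw [val_atTop_of_ne X g _ hf]
    exact (map_zero (T f).1).trans (X.val_atTop_of_ne g _ hf).symm

/-- Every coordinate `f ≠ g` lies in `X_f I_{f⁻¹g} = 0`, while the coordinate at `g` ranges over
`X_g I_1 = X_g`. -/
theorem atTop_surjective (hP : IsQuasiLatticeOrdered P)
    (hinj : ∀ (x y : G) (f : PHom P x y), Function.Injective (X.φ f)) :
    Function.Surjective (X.atTop g) := fun ξ => by
  refine ⟨ξ.val (Below.top g), Cc.ext X g fun f => ?_⟩
  by_cases hf : f = Below.top g
  · subst hf
    exact X.val_atTop g _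
  · have := fib_eq_bot X g hP f.1 f.2 (fun e => hf (Subtype.ext e)) (hinj _ _ _)
    have h2 : ξ.val f ∈ X.fib f.1 (quot f.2) := (DFinsupp.toFun ξ f).2
    rw [this] at h2
    exact (X.val_atTop_of_ne g _ hf).trans ((Submodule.mem_bot ℂ).1 h2).symm

/-- The inclusion of `X_g` in `X̃_g`. -/
def toXtilde : X.X g →ₗ[ℂ] X.Xtilde g :=
  (UniformSpace.Completion.toComplL (𝕜 := ℂ) (E := X.Cc g)).toLinearMap ∘ₗ X.atTop g

theorem toXtilde_injective :
    Function.Injective (X.toXtilde g) := fun ζ ζ' h => by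
  rw [← X.val_atTop g ζ, ← X.val_atTop g ζ', UniformSpace.Completion.coe_injective _ h]

theorem denseRange_toXtilde (hP : IsQuasiLatticeOrdered P)
    (hinj : ∀ (x y : G) (f : PHom P x y), Function.Injective (X.φ f)) :
    DenseRange (X.toXtilde g) :=
  UniformSpace.Completion.denseRange_coe.comp (X.atTop_surjective g hP hinj).denseRange
    (UniformSpace.Completion.continuous_coe _)

theorem ltilde_toXtilde {z : G} (f : PHom P z y) (T : X.L f)
    (ζ : X.X g) : X.ltilde g f T (X.toXtilde g ζ) = X.toXtilde g (X.ell f g T ζ) :=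
  (X.diag_coe g _ _ _ _ _).trans (congrArg _ (X.diagₗ_atTop g _ ζ))

theorem phitilde_toXtilde (a : X.A y) (ζ : X.X g) :
    X.phitilde g a (X.toXtilde g ζ) = X.toXtilde g (X.φ g a ζ) :=
  (X.diag_coe g _ _ _ _ _).trans (congrArg _ (X.diagₗ_atTop g _ ζ))

/-- `φ̃_g` restricts to `φ_g` on the summand `X_g`, so it inherits injectivity. -/
theorem isTildeInjective
    (hinj : ∀ (x y : G) (f : PHom P x y), Function.Injective (X.φ f)) : X.IsTildeInjective :=
  fun x y g a b hab => hinj x y g <| Subtype.ext <| ContinuousLinearMap.ext fun ζ =>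
    X.toXtilde_injective g <| by
      rw [← phitilde_toXtilde, ← phitilde_toXtilde, hab]

/-- The inclusion `X_g → X̃_g` intertwines the two sums. Its injectivity gives one direction and its
dense range the other. -/
theorem sum_ltilde_eq_zero_iff (hP : IsQuasiLatticeOrdered P)
    (hinj : ∀ (x y : G) (f : PHom P x y), Function.Injective (X.φ f)) (F : Finset (PTo P y))
    (T : ∀ f : PTo P y, X.L f.hom) :
    ∑ f ∈ F, X.ltilde g f.hom (T f) = 0 ↔ ∑ f ∈ F, X.ell f.hom g (T f) = 0 := by
  have key : ∀ ζ, (∑ f ∈ F, X.ltilde g f.hom (T f)) (X.toXtilde g ζ) =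
      X.toXtilde g ((∑ f ∈ F, X.ell f.hom g (T f) : X.L g) ζ) := fun ζ => by
    classical
    induction F using Finset.induction_on with
    | empty => exact (map_zero (X.toXtilde g)).symm
    | insert f F hf ih =>
      rw [Finset.sum_insert hf, Finset.sum_insert hf, add_apply, ih,
        ltilde_toXtilde, Adjointable.add_apply, map_add]
  constructor
  · intro h
    refine Subtype.ext <| ContinuousLinearMap.ext fun ζ => X.toXtilde_injective g ?_
    refine (key ζ).symm.trans ?_
    rw [h]
    exact (map_zero (X.toXtilde g)).symm
  · intro h
    refine DFunLike.coe_injective ((X.denseRange_toXtilde g hP hinj).equalizer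
      (ContinuousLinearMap.continuous _) (ContinuousLinearMap.continuous _) (funext fun ζ => ?_))
    refine (key ζ).trans ?_
    rw [h]
    exact map_zero (X.toXtilde g)

end tilde

end ProductSystem

end ProdSys

end

/-! ### The equivalence -/

theorem mainTheorem5 {G : Type u} [Groupoid.{v} G] (P : MorphismProperty G) [P.IsMultiplicative]
    (hP : IsQuasiLatticeOrdered P) (X : ProductSystem.{u, v, w₁, w₂} P)
    (hX : X.IsCompactlyAligned)
    (hlub : ∀ (y : G) (f g : PTo P y), ∃ k : PTo P y, IsLUB {f, g} k)
    (hinj : ∀ (x y : G) (f : PHom P x y), Function.Injective (X.φ f))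
    (hcpt : ∀ (x y : G) (f : PHom P x y) (a : X.A y), X.φ f a ∈ X.K f)
    {H : Type*} [NormedAddCommGroup H] [InnerProductSpace ℂ H] [CompleteSpace H]
    (ψ : X.ToeplitzRep (H →L[ℂ] H))
    (horth : ∀ x y : G, x ≠ y → ∀ (a : X.A x) (b : X.A y), ψ.hom x a * ψ.hom y b = 0) :
    ψ.IsCNPCovariant hX ↔
      ∀ (x y : G) (f : PHom P x y) (a : X.A y), ψ.up f ⟨X.φ f a, hcpt x y f a⟩ = ψ.hom y a := by
  classical
  constructor
  · intro hψ x y f a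
    -- For `f = 1_y` the two-element index set used below would degenerate, and the identity holds
    -- for every Toeplitz representation.
    by_cases hf : (⟨x, f⟩ : PTo P y) = PTo.one y
    · cases hf
      exact ψ.up_one_φ (hcpt _ _ _) a
    -- Signs for the family `φ_1(a)`, `-φ_f(a)`; only the values at `1_y` and `f` enter the sum.
    · let c : PTo P y → ℂ := fun p => if p = PTo.one y then 1 else -1
      have hc : c (PTo.one y) = 1 := if_pos rfl
      have hc' : c ⟨x, f⟩ = -1 := if_neg hf
      have h := hψ.cuntzPimsner.sum_eq_zero y {PTo.one y, ⟨x, f⟩}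
        (fun p => c p • ⟨X.φ p.hom a, hcpt _ _ p.hom a⟩) ?_
      · simp only [map_smul] at h
        rw [Finset.sum_pair (Ne.symm hf), hc, hc', one_smul, neg_smul, one_smul,
          ← sub_eq_add_neg, sub_eq_zero] at h
        exact h.symm.trans (ψ.up_one_φ (hcpt _ _ (PHom.one y)) a)
      · intro f₀
        -- Any `g ≥ f₀ ∨ f` lies above both `1_y` and `f`, so neither `l^g` is zero by convention
        -- and the two terms cancel as `φ_g(a) - φ_g(a)`.
        obtain ⟨k, hk⟩ := hlub y f₀ ⟨x, f⟩
        refine ⟨k, hk.1 (by simp), fun g hg => ?_⟩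
        refine (X.sum_ltilde_eq_zero_iff g.hom hP hinj _ (fun p =>
          c p • X.φ p.hom a)).2 ?_
        have h1 : MorLE P (PHom.one (P := P) y).1 g.hom.1 := one_morLE g.hom
        have h2 : MorLE P f.1 g.hom.1 :=
          (hk.1 (by simp) : (⟨x, f⟩ : PTo P y) ≤ k).trans hg
        rw [Finset.sum_pair (Ne.symm hf), hc, hc', one_smul, neg_smul, one_smul,
          ← X.ellL_apply h2, map_neg, X.ellL_apply h2, X.ell_φ h2]
        exact (congrArg (· + _) (X.ell_φ h1 a)).trans (add_neg_cancel _)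
  · intro hψ
    have hup : ∀ (y : G) (f k : PTo P y) (h : f ≤ k) (S : X.K f.hom),
        ψ.up k.hom (X.ellK h (hcpt _ _ _) S) = ψ.up f.hom S := fun y f k h S =>
      ψ.up_ellK h (hcpt _ _ _) (hψ _ _ _) S
    -- The case of two morphisms with the same target and no common upper bound cannot occur, by
    -- `hlub`.
    refine ⟨⟨fun y f g k hk S T => ?_, fun y f g h => (h ?_).elim, fun y z hyz f g S T =>
      ψ.up_mul_up_eq_zero f.hom g.hom (horth y z hyz) S T⟩,
      ⟨X.isTildeInjective hinj, fun y F T hT => ?_⟩⟩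
    -- Both factors move to `k = f ∨ g`, where the product of the amplifications is `S ∨ T` by
    -- definition.
    · rw [← hup y f k (hk.1 (by simp)) S, ← hup y g k (hk.1 (by simp)) T, ψ.up_mul_up]
      rfl
    · obtain ⟨k, hk⟩ := hlub y f g
      exact ⟨k, hk.1⟩
    · have : IsDirectedOrder (PTo P y) := ⟨fun f g => by
        obtain ⟨k, hk⟩ := hlub y f g
        exact ⟨k, hk.1 (by simp), hk.1 (by simp)⟩⟩
      have : Nonempty (PTo P y) := ⟨PTo.one y⟩
      obtain ⟨f₀, hf₀⟩ := F.exists_le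
      -- Largeness is tested at an upper bound `f₀` of `F`: the resulting `k` dominates all of `F`,
      -- and the sum vanishes at `k` itself.
      obtain ⟨k, hk, hk'⟩ := hT f₀
      have h0 := (X.sum_ltilde_eq_zero_iff k.hom hP hinj F (fun f => (T f).1)).1 (hk' k le_rfl)
      have hle : ∀ f ∈ F, f ≤ k := fun f hf => (hf₀ f hf).trans hk
      -- The value `0` outside `f ≤ k` is never met on `F`.
      let T' : PTo P y → X.K k.hom := fun f =>
        if h : f ≤ k then X.ellK h (hcpt _ _ _) (T f) else 0
      have h1 : ∀ f ∈ F, ψ.up f.hom (T f) = ψ.up k.hom (T' f) := fun f hf => by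
        rw [← hup y f k (hle f hf), show T' f = _ from dif_pos (hle f hf)]
      have h2 : ∑ f ∈ F, T' f = 0 := Subtype.ext <| by
        rw [Submodule.coe_sum]
        refine (Finset.sum_congr rfl fun f hf => ?_).trans h0
        rw [show T' f = _ from dif_pos (hle f hf)]
        rfl
      rw [Finset.sum_congr rfl h1, ← map_sum, h2, map_zero]
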